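/- Consider the class of dissipative shallow-water systems \[ u_t+uu_x+h_x-F(h,u_x,h_x)\,u_{xx}=0,\qquad h_t+uh_x+hu_x=0 \] for $u(t,x)$ and $h(t,x)$, where the arbitrary element $F$ runs through the smooth real functions of $(h,u_x,h_x)$ on nonempty open subsets of $\mathbb R^3$; the result holds both without further restriction on $F$ and under the constitutive inequality $F\neq0$ (i.e. for nowhere vanishing $F$). An equivalence transformation of the class is a (local) point transformation of the space with coordinates $(t,x,u,h)$, the derivatives of $u,h$ up to order two, and $F$, that is projectable on the spaces of $(t,x,u,h)$ and of its derivatives (its projection to the derivatives being the prolongation of a local diffeomorphism of the space of $(t,x,u,h)$), that maps every arbitrary element $F$ of the class to an arbitrary element $F'$ of the class, and whose projection maps the system with $F$ to the system with $F'$. Transformations are considered over a domain (nonempty connected open set) $U$ of values of $(t,x,u,h)$ and a nonempty open set $W\subseteq\mathbb R$ of values of $F$, at all derivatives at which the prolongation is defined. The equivalence algebra $\mathfrak g^\sim$ consists of the smooth vector fields that generate local one-parameter groups of equivalence transformations; it is written through components along $\partial_t,\partial_x,\partial_u,\partial_h,\partial_F$, the first four depending on $(t,x,u,h)$ only and the last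 one a priori on all variables. \textbf{Theorem.} The equivalence algebra $\mathfrak g^\sim$ has the basis \[ \partial_t,\quad \partial_x,\quad t\partial_x+\partial_u,\quad t\partial_t-u\partial_u-2h\partial_h-F\partial_F,\quad x\partial_x+u\partial_u+2h\partial_h+2F\partial_F , \] that is, these five vector fields are linearly independent and, over any $U$ and $W$ as above, a vector field belongs to the equivalence algebra if and only if it is the restriction of a real linear combination of them. Besides the continuous equivalence transformations generated by these fields, the class admits two discrete equivalence transformations, \[ (t,x,u,h,F)\mapsto(-t,-x,u,h,-F),\qquad (t,x,u,h,F)\mapsto(-t,x,-u,h,-F), \] which are independent modulo the continuous ones (neither of them, nor their product, belongs to the group generated by the continuous transformations). The continuous and the discrete transformations together generate the whole equivalence group $G^\sim$: over any $U$ and $W$ as above, a transformation is an equivalence transformation if and only if it is the restriction of an element of the group of transformations of the space of $(t,x,u,h,F)$ generated by the flows of the linear combinations of the five fields and by the two discrete transformations. -/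

import Mathlib

open scoped ContDiff

noncomputable section

namespace ShallowWater

/-- The space of the independent and dependent variables, with coordinates `(t, x, u, h)`. -/
abbrev Base : Type := Fin 4 → ℝ

/-- The space of `(t, x)` and the derivatives of `(u, h)` up to order two, with coordinates
`0: t, 1: x, 2: u, 3: h, 4: u_t, 5: u_x, 6: h_t, 7: h_x,
8: u_tt, 9: u_tx, 10: u_xx, 11: h_tt, 12: h_tx, 13: h_xx`. -/
abbrev Jet : Type := Fin 14 → ℝ

/-- The jet space extended by one coordinate for the value of the arbitrary element `F`. -/
abbrev ExtJet : Type := Jet × ℝ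

/-- The space with coordinates `((t, x, u, h), F)`. -/
abbrev Total : Type := Base × ℝ

/-- The projection of the jet space onto the space of `(t, x, u, h)`. -/
def toBase (j : Jet) : Base := ![j 0, j 1, j 2, j 3]

/-- The projection of the extended jet space onto the space of `(t, x, u, h, F)`. -/
def toTotal (m : ExtJet) : Total := (toBase m.1, m.2)

/-- The arguments `(h, u_x, h_x)` of the arbitrary element. -/
def args (j : Jet) : Fin 3 → ℝ := ![j 3, j 5, j 7]

/-! ### The class of dissipative shallow-water equations -/

/-- An arbitrary element of the class: a smooth real function `F = F(h, u_x, h_x)` on a nonempty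
open set `dom`. -/
structure ArbElem where
  dom : Set (Fin 3 → ℝ)
  toFun : (Fin 3 → ℝ) → ℝ
  isOpen_dom : IsOpen dom
  nonempty_dom : dom.Nonempty
  smooth : ContDiffOn ℝ ∞ toFun dom

/-- All arbitrary elements. -/
def allElements : Set ArbElem := Set.univ

/-- The arbitrary elements satisfying the constitutive inequality `F ≠ 0`. -/
def nonvanishingElements : Set ArbElem := {θ | ∀ y ∈ θ.dom, θ.toFun y ≠ 0}

/-- The system with arbitrary element `F`, as a subset of the jet space:
`u_t + u u_x + h_x - F(h, u_x, h_x) u_xx = 0` and `h_t + u h_x + h u_x = 0`. -/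
def system (θ : ArbElem) : Set Jet :=
  {j | args j ∈ θ.dom ∧
    j 4 + j 2 * j 5 + j 7 - θ.toFun (args j) * j 10 = 0 ∧
    j 6 + j 2 * j 7 + j 3 * j 5 = 0}

/-- The graph of an arbitrary element in the extended jet space. -/
def graph (θ : ArbElem) : Set ExtJet :=
  {m | args m.1 ∈ θ.dom ∧ m.2 = θ.toFun (args m.1)}

/-! ### Prolongation of point transformations -/

/-- The total derivative `D_t`, for functions of the jet variables of order at most one. -/
def totalT (A : Jet → ℝ) (j : Jet) : ℝ :=
  fderiv ℝ A j ![1, 0, j 4, j 6, j 8, j 9, j 11, j 12, 0, 0, 0, 0, 0, 0]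

/-- The total derivative `D_x`, for functions of the jet variables of order at most one. -/
def totalX (A : Jet → ℝ) (j : Jet) : ℝ :=
  fderiv ℝ A j ![0, 1, j 5, j 7, j 9, j 10, j 12, j 13, 0, 0, 0, 0, 0, 0]

/-- The `i`-th component of a transformation of `(t, x, u, h)`, as a function on jets. -/
def comp (g : Base → Base) (i : Fin 4) (j : Jet) : ℝ := g (toBase j) i

/-- The Jacobian determinant `D_t t' D_x x' - D_x t' D_t x'` of the new independent variables. -/
def jac (g : Base → Base) (j : Jet) : ℝ :=
  totalT (comp g 0) j * totalX (comp g 1) j - totalX (comp g 0) j * totalT (comp g 1) j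

/-- The total derivative with respect to the new variable `t'`, where
`D_t = (D_t t') D_t' + (D_t x') D_x'` and `D_x = (D_x t') D_t' + (D_x x') D_x'`. -/
def newT (g : Base → Base) (A : Jet → ℝ) (j : Jet) : ℝ :=
  (totalX (comp g 1) j * totalT A j - totalT (comp g 1) j * totalX A j) / jac g j

/-- The total derivative with respect to the new variable `x'`. -/
def newX (g : Base → Base) (A : Jet → ℝ) (j : Jet) : ℝ :=
  (totalT (comp g 0) j * totalX A j - totalX (comp g 0) j * totalT A j) / jac g j

/-- The second prolongation of the point transformation `(t', x', u', h') = g(t, x, u, h)`,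
defined at the jets at which `jac g` does not vanish. -/
def prolong (g : Base → Base) (j : Jet) : Jet :=
  let u := comp g 2
  let h := comp g 3
  ![comp g 0 j, comp g 1 j, u j, h j,
    newT g u j, newX g u j, newT g h j, newX g h j,
    newT g (newT g u) j, newX g (newT g u) j, newX g (newX g u) j,
    newT g (newT g h) j, newX g (newT g h) j, newX g (newX g h) j]

/-- A transformation of the extended jet space that is projectable on the spaces of
`(t, x, u, h)` and of its derivatives: the variables `(t, x, u, h)` are transformed by `base`, the
derivatives by prolongation of `base`, and the value of `F` by a function `arb` of all variables. -/
structure Transf where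
  base : Base → Base
  arb : ExtJet → ℝ

/-- The action of a transformation on the extended jet space. -/
def Transf.act (φ : Transf) (m : ExtJet) : ExtJet := (prolong φ.base m.1, φ.arb m)

/-- The part of the extended jet space over a set `U` of values of `(t, x, u, h)` and a set `W` of
values of `F`. -/
def cylinder (U : Set Base) (W : Set ℝ) : Set ExtJet := {m | toBase m.1 ∈ U ∧ m.2 ∈ W}

/-- The part of `cylinder U W` on which the prolonged transformation is defined. -/
def Transf.domain (φ : Transf) (U : Set Base) (W : Set ℝ) : Set ExtJet :=
  {m ∈ cylinder U W | jac φ.base m.1 ≠ 0}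

/-! ### Equivalence transformations and the equivalence algebra -/

/-- A (local) equivalence transformation, over the open sets `U` and `W`, of the class with set of
arbitrary elements `S`: a local diffeomorphism which maps every arbitrary element
`θ` in `S` to some `θ'` in `S` and the system with `θ` to the system with `θ'`. -/
structure IsEquivalenceTransformation (S : Set ArbElem) (U : Set Base) (W : Set ℝ)
    (φ : Transf) : Prop where
  smooth_base : ContDiffOn ℝ ∞ φ.base U
  injOn_base : Set.InjOn φ.base U
  bijective_base : ∀ z ∈ U, Function.Bijective (fderiv ℝ φ.base z)
  smooth_arb : ContDiffOn ℝ ∞ φ.arb (φ.domain U W)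
  injOn_act : Set.InjOn φ.act (φ.domain U W)
  deriv_arb : ∀ m ∈ φ.domain U W, fderiv ℝ φ.arb m (0, 1) ≠ 0
  maps_class : ∀ θ ∈ S, ∃ θ' ∈ S,
    φ.act '' (graph θ ∩ φ.domain U W) = graph θ' ∩ φ.act '' φ.domain U W ∧
    ∀ m ∈ graph θ ∩ φ.domain U W, m.1 ∈ system θ ↔ prolong φ.base m.1 ∈ system θ'

/-- `Q = τ ∂_t + ξ ∂_x + η ∂_u + χ ∂_h + ω ∂_F`, given by its coefficients `((τ, ξ, η, χ), ω)` as
functions on the extended jet space over `U` and `W`, belongs to the equivalence algebra: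
`(τ, ξ, η, χ)` depend on `(t, x, u, h)` only, and near every point `Q` generates a local
one-parameter group of equivalence transformations `φ s`. -/
structure IsInfinitesimalEquivalence (S : Set ArbElem) (U : Set Base) (W : Set ℝ)
    (Q : ExtJet → Total) : Prop where
  smooth : ContDiffOn ℝ ∞ Q (cylinder U W)
  projectable : ∃ Q₀ : Base → Base, ∀ m ∈ cylinder U W, (Q m).1 = Q₀ (toBase m.1)
  generates : ∀ z ∈ U, ∀ c ∈ W, ∃ U₁ ⊆ U, ∃ W₁ ⊆ W, ∃ ε > 0, ∃ φ : ℝ → Transf,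
    IsOpen U₁ ∧ IsConnected U₁ ∧ z ∈ U₁ ∧ IsOpen W₁ ∧ c ∈ W₁ ∧
    (∀ s, |s| < ε → IsEquivalenceTransformation S U₁ W₁ (φ s)) ∧
    ContDiffOn ℝ ∞ (fun p : ℝ × Base => (φ p.1).base p.2) {p | |p.1| < ε ∧ p.2 ∈ U₁} ∧
    ContDiffOn ℝ ∞ (fun p : ℝ × ExtJet => (φ p.1).arb p.2)
      {p | |p.1| < ε ∧ p.2 ∈ (φ p.1).domain U₁ W₁} ∧
    (∀ z' ∈ U₁, (φ 0).base z' = z') ∧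
    (∀ m ∈ cylinder U₁ W₁, (φ 0).arb m = m.2) ∧
    ∀ s, |s| < ε → ∀ m ∈ (φ s).domain U₁ W₁,
      (φ s).act m ∈ cylinder U W ∧
      HasDerivAt (fun r => (((φ r).base (toBase m.1), (φ r).arb m) : Total))
        (Q ((φ s).act m)) s

/-- The vector fields `∂_t`, `∂_x`, `t ∂_x + ∂_u`, `t ∂_t - u ∂_u - 2h ∂_h - F ∂_F` and
`x ∂_x + u ∂_u + 2h ∂_h + 2F ∂_F` on the space of `(t, x, u, h, F)`. -/
def basisField : Fin 5 → Total → Total :=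
  ![fun _ => (![1, 0, 0, 0], 0),
    fun _ => (![0, 1, 0, 0], 0),
    fun y => (![0, y.1 0, 1, 0], 0),
    fun y => (![y.1 0, 0, -y.1 2, -2 * y.1 3], -y.2),
    fun y => (![0, y.1 1, y.1 2, 2 * y.1 3], 2 * y.2)]

/-- The linear span of the five vector fields. -/
def fieldSpan : Submodule ℝ (Total → Total) := Submodule.span ℝ (Set.range basisField)

/-- `σ` is the time-one map of the flow of the vector field `v`. -/
def IsTimeOneMap (v : Total → Total) (σ : Equiv.Perm Total) : Prop :=
  ∀ y, ∃ γ : ℝ → Total, γ 0 = y ∧ (∀ s, HasDerivAt γ (v (γ s)) s) ∧ γ 1 = σ y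

/-- The group generated by the one-parameter groups of the fields in `fieldSpan`. -/
def continuousGroup : Subgroup (Equiv.Perm Total) :=
  Subgroup.closure {σ | ∃ v ∈ fieldSpan, IsTimeOneMap v σ}

/-- The transformation `(t, x, u, h, F) ↦ (-t, -x, u, h, -F)`. -/
def discrete₁ : Equiv.Perm Total :=
  Function.Involutive.toPerm (fun y => (![-y.1 0, -y.1 1, y.1 2, y.1 3], -y.2)) (by
    intro y
    refine Prod.ext ?_ (by simp)
    funext i
    fin_cases i <;> simp)

/-- The transformation `(t, x, u, h, F) ↦ (-t, x, -u, h, -F)`. -/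
def discrete₂ : Equiv.Perm Total :=
  Function.Involutive.toPerm (fun y => (![-y.1 0, y.1 1, -y.1 2, y.1 3], -y.2)) (by
    intro y
    refine Prod.ext ?_ (by simp)
    funext i
    fin_cases i <;> simp)

/-- The group generated by the continuous transformations and the two discrete ones. -/
def generatedGroup : Subgroup (Equiv.Perm Total) :=
  continuousGroup ⊔ Subgroup.closure {discrete₁, discrete₂}

end ShallowWater

end

/-!
An equivalence transformation acts on the arbitrary elements, and constant arbitrary elements
are enough to determine it. The transformed element depends on `(h', u'_x, h'_x)` alone, so
jets at which the arbitrary element and these three quantities agree have the same image `F'`;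
this forces `t'` to depend on `t` only. The transformed mass equation then shows that `x'` and
`h'` do not depend on `u`, and the transformed momentum equation, a polynomial identity in
`u_xx`, `h_xx` and `F`, that `x'` and `u'` do not depend on `h` and that `F' = F x'_x² / t'_t`.
Splitting what is left with respect to the remaining free derivatives leaves affine
transformations, the similarities of the equations: time and length rescalings, translations
and Galilean boosts. Conversely the flow of a combination of the five fields is an explicit
similarity, and the sign changes of `t` and `x` are the two discrete ones.
-/

noncomputable section

namespace ShallowWater

open Filter Topology

/-! ### Similarities and their flows -/

/-- The transformations `t' = τ t + t₀`, `x' = τ b x + τ k t + x₀`, `u' = b u + k`, `h' = b² h`,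
`F' = τ b² F`, which turn out to be the equivalence transformations of the class. The factor of
`x` is `τ b` because `u` is a velocity. -/
@[ext]
structure Similarity where
  τ : ℝˣ
  b : ℝˣ
  k : ℝ
  t₀ : ℝ
  x₀ : ℝ

theorem base_ext {z z' : Base} (h0 : z 0 = z' 0) (h1 : z 1 = z' 1) (h2 : z 2 = z' 2)
    (h3 : z 3 = z' 3) : z = z' := by
  funext i
  fin_cases i <;> assumption

theorem total_ext {y y' : Total} (h0 : y.1 0 = y'.1 0) (h1 : y.1 1 = y'.1 1)
    (h2 : y.1 2 = y'.1 2) (h3 : y.1 3 = y'.1 3) (h4 : y.2 = y'.2) : y = y' :=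
  Prod.ext (base_ext h0 h1 h2 h3) h4

namespace Similarity

instance : Mul Similarity :=
  ⟨fun f g => ⟨f.τ * g.τ, f.b * g.b, f.b * g.k + f.k, f.τ * g.t₀ + f.t₀,
    f.τ * f.b * g.x₀ + f.τ * f.k * g.t₀ + f.x₀⟩⟩

instance : One Similarity := ⟨⟨1, 1, 0, 0, 0⟩⟩

instance : Inv Similarity :=
  ⟨fun f => ⟨f.τ⁻¹, f.b⁻¹, -f.k / f.b, -f.t₀ / f.τ, (f.k * f.t₀ - f.x₀) / (f.τ * f.b)⟩⟩

theorem mul_def (f g : Similarity) : f * g = ⟨f.τ * g.τ, f.b * g.b, f.b * g.k + f.k,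
    f.τ * g.t₀ + f.t₀, f.τ * f.b * g.x₀ + f.τ * f.k * g.t₀ + f.x₀⟩ := rfl

theorem one_def : (1 : Similarity) = ⟨1, 1, 0, 0, 0⟩ := rfl

theorem inv_def (f : Similarity) : f⁻¹ = ⟨f.τ⁻¹, f.b⁻¹, -f.k / f.b, -f.t₀ / f.τ,
    (f.k * f.t₀ - f.x₀) / (f.τ * f.b)⟩ := rfl

instance : Group Similarity :=
  Group.ofLeftAxioms
    (fun f g h => by
      simp only [mul_def, Similarity.mk.injEq, Units.val_mul]
      refine ⟨mul_assoc _ _ _, mul_assoc _ _ _, ?_, ?_, ?_⟩ <;> ring)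
    (fun f => by ext <;> simp [mul_def, one_def])
    (fun f => by
      simp only [mul_def, one_def, inv_def, Similarity.mk.injEq, inv_mul_cancel, true_and,
        Units.val_inv_eq_inv_val]
      refine ⟨?_, ?_, ?_⟩ <;> field_simp <;> ring)

/-- The action of a similarity on the space of `(t, x, u, h)`. -/
def base (f : Similarity) (z : Base) : Base :=
  ![f.τ * z 0 + f.t₀, f.τ * f.b * z 1 + f.τ * f.k * z 0 + f.x₀, f.b * z 2 + f.k, f.b ^ 2 * z 3]

/-- The action of a similarity on the space of `(t, x, u, h, F)`. -/
def act (f : Similarity) (y : Total) : Total := (f.base y.1, f.τ * f.b ^ 2 * y.2)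

theorem act_one (y : Total) : act 1 y = y := by
  apply total_ext <;> simp [act, base, one_def]

theorem act_mul (f g : Similarity) (y : Total) : (f * g).act y = f.act (g.act y) := by
  apply total_ext <;> simp [act, base, mul_def] <;> ring

/-- The action of similarities on the space of `(t, x, u, h, F)`, as a representation by
permutations. -/
def toPerm : Similarity →* Equiv.Perm Total :=
  MonoidHom.toHomPerm
    { toFun := act
      map_one' := funext act_one
      map_mul' := fun f g => funext (act_mul f g) }

@[simp]
theorem toPerm_apply (f : Similarity) (y : Total) : toPerm f y = f.act y := rfl

theorem base_one (z : Base) : base 1 z = z := congrArg Prod.fst (act_one (z, 0))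

theorem base_mul (f g : Similarity) (z : Base) : (f * g).base z = f.base (g.base z) :=
  congrArg Prod.fst (act_mul f g (z, 0))

theorem base_injective (f : Similarity) : Function.Injective f.base :=
  Function.LeftInverse.injective (g := f⁻¹.base) fun z => by
    rw [← base_mul, inv_mul_cancel, base_one]

end Similarity

theorem exists_add_const_mem {V : Set Base} (hV : IsOpen V) {z : Base} (hz : z ∈ V) :
    ∃ δ : ℝ, δ ≠ 0 ∧ (fun i => z i + δ) ∈ V := by
  have hc : ContinuousAt (fun (δ : ℝ) (i : Fin 4) => z i + δ) 0 := by fun_prop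
  have hmem : ∀ᶠ δ : ℝ in 𝓝[≠] 0, (fun i => z i + δ) ∈ V :=
    nhdsWithin_le_nhds (hc.eventually (hV.mem_nhds (by simpa only [add_zero] using hz)))
  obtain ⟨δ, hδV, hδ⟩ := (hmem.and self_mem_nhdsWithin).exists
  exact ⟨δ, hδ, hδV⟩

namespace Similarity

theorem eq_of_eqOn_base {V : Set Base} (hV : IsOpen V) (hne : V.Nonempty) {f g : Similarity}
    (h : Set.EqOn f.base g.base V) : f = g := by
  obtain ⟨z, hz⟩ := hne
  obtain ⟨δ, hδ, hz'⟩ := exists_add_const_mem hV hz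
  have e := congrFun (h hz)
  have e' := congrFun (h hz')
  have ht : f.τ * z 0 + f.t₀ = g.τ * z 0 + g.t₀ := e 0
  have ht' : f.τ * (z 0 + δ) + f.t₀ = g.τ * (z 0 + δ) + g.t₀ := e' 0
  have hu : f.b * z 2 + f.k = g.b * z 2 + g.k := e 2
  have hu' : f.b * (z 2 + δ) + f.k = g.b * (z 2 + δ) + g.k := e' 2
  have hx : f.τ * f.b * z 1 + f.τ * f.k * z 0 + f.x₀ =
      g.τ * g.b * z 1 + g.τ * g.k * z 0 + g.x₀ := e 1
  have hτ : (f.τ : ℝ) = g.τ := mul_left_cancel₀ hδ (by linear_combination ht' - ht)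
  have hb : (f.b : ℝ) = g.b := mul_left_cancel₀ hδ (by linear_combination hu' - hu)
  have hk : f.k = g.k := by linear_combination hu - z 2 * hb
  have ht₀ : f.t₀ = g.t₀ := by linear_combination ht - z 0 * hτ
  have hx₀ : f.x₀ = g.x₀ := by
    rw [hτ, hb, hk] at hx
    exact add_left_cancel hx
  exact Similarity.ext (Units.ext hτ) (Units.ext hb) hk ht₀ hx₀

theorem toPerm_injective : Function.Injective toPerm := fun _ _ h =>
  eq_of_eqOn_base isOpen_univ Set.univ_nonempty fun z _ =>
    congrArg Prod.fst (DFunLike.congr_fun h (z, 0))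

theorem hasDerivAt_act {f : ℝ → Similarity} {s τ' b' k' t₀' x₀' : ℝ}
    (hτ : HasDerivAt (fun r => ((f r).τ : ℝ)) τ' s) (hb : HasDerivAt (fun r => ((f r).b : ℝ)) b' s)
    (hk : HasDerivAt (fun r => (f r).k) k' s) (ht₀ : HasDerivAt (fun r => (f r).t₀) t₀' s)
    (hx₀ : HasDerivAt (fun r => (f r).x₀) x₀' s) (y : Total) :
    HasDerivAt (fun r => (f r).act y)
      ((![τ' * y.1 0 + t₀', (τ' * (f s).b + (f s).τ * b') * y.1 1 +
          (τ' * (f s).k + (f s).τ * k') * y.1 0 + x₀', b' * y.1 2 + k',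
          2 * (f s).b * b' * y.1 3],
        (τ' * (f s).b ^ 2 + (f s).τ * (2 * (f s).b * b')) * y.2) : Total) s := by
  have hb2 : HasDerivAt (fun r => ((f r).b : ℝ) ^ 2) (2 * (f s).b * b') s :=
    (hb.fun_pow 2).congr_deriv (by norm_num)
  refine HasDerivAt.prodMk (hasDerivAt_pi.2 fun i => ?_) ((hτ.mul hb2).mul_const y.2)
  fin_cases i
  · exact (hτ.mul_const (y.1 0)).add ht₀
  · exact (((hτ.mul hb).mul_const (y.1 1)).add ((hτ.mul hk).mul_const (y.1 0))).add hx₀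
  · exact (hb.mul_const (y.1 2)).add hk
  · exact hb2.mul_const (y.1 3)

end Similarity

/-- The linear combination of the fields `basisField` with coefficients `c`. -/
def field (c : Fin 5 → ℝ) (y : Total) : Total :=
  (![c 0 + c 3 * y.1 0, c 1 + c 2 * y.1 0 + c 4 * y.1 1, c 2 + (c 4 - c 3) * y.1 2,
    2 * (c 4 - c 3) * y.1 3], (2 * c 4 - c 3) * y.2)

theorem sum_smul_basisField (c : Fin 5 → ℝ) : ∑ i, c i • basisField i = field c := by
  funext y
  apply total_ext <;> simp [basisField, field, Fin.sum_univ_five] <;> ring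

theorem mem_fieldSpan_iff {v : Total → Total} : v ∈ fieldSpan ↔ ∃ c, v = field c := by
  rw [fieldSpan, Submodule.mem_span_range_iff_exists_fun]
  simp only [sum_smul_basisField, eq_comm]

theorem eq_of_eqOn_field {V : Set Base} (hV : IsOpen V) (hne : V.Nonempty)
    {c c' : Fin 5 → ℝ} (h : ∀ z ∈ V, (field c (z, 0)).1 = (field c' (z, 0)).1) : c = c' := by
  obtain ⟨z, hz⟩ := hne
  obtain ⟨δ, hδ, hz'⟩ := exists_add_const_mem hV hz
  have e := congrFun (h z hz)
  have e' := congrFun (h _ hz')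
  have ht : c 0 + c 3 * z 0 = c' 0 + c' 3 * z 0 := e 0
  have ht' : c 0 + c 3 * (z 0 + δ) = c' 0 + c' 3 * (z 0 + δ) := e' 0
  have hu : c 2 + (c 4 - c 3) * z 2 = c' 2 + (c' 4 - c' 3) * z 2 := e 2
  have hu' : c 2 + (c 4 - c 3) * (z 2 + δ) = c' 2 + (c' 4 - c' 3) * (z 2 + δ) := e' 2
  have hx : c 1 + c 2 * z 0 + c 4 * z 1 = c' 1 + c' 2 * z 0 + c' 4 * z 1 := e 1
  have h3 : c 3 = c' 3 := mul_left_cancel₀ hδ (by linear_combination ht' - ht)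
  have h4 : c 4 = c' 4 := mul_left_cancel₀ hδ (by linear_combination hu' - hu + δ * h3)
  have h0 : c 0 = c' 0 := by linear_combination ht - z 0 * h3
  have h2 : c 2 = c' 2 := by linear_combination hu - z 2 * (h4 - h3)
  have h1 : c 1 = c' 1 := by linear_combination hx - z 0 * h2 - z 1 * h4
  funext i
  fin_cases i <;> assumption

theorem linearIndependent_basisField : LinearIndependent ℝ basisField := by
  rw [Fintype.linearIndependent_iff]
  intro c hc
  have hc0 : field c = field 0 := by rw [← sum_smul_basisField, hc, ← sum_smul_basisField]; simp
  exact congrFun (eq_of_eqOn_field isOpen_univ Set.univ_nonempty fun z _ => by rw [hc0]; rfl)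

/-- The solution of `y' = a y + f` with `y(0) = 0`, by Duhamel's formula. -/
def duhamel (a : ℝ) (f : ℝ → ℝ) (s : ℝ) : ℝ :=
  Real.exp (a * s) * ∫ r in (0 : ℝ)..s, Real.exp (-(a * r)) * f r

theorem duhamel_at_zero (a : ℝ) (f : ℝ → ℝ) : duhamel a f 0 = 0 := by simp [duhamel]

theorem duhamel_zero_right (a s : ℝ) : duhamel a (fun _ => 0) s = 0 := by simp [duhamel]

theorem duhamel_zero_left_const (c s : ℝ) : duhamel 0 (fun _ => c) s = s * c := by simp [duhamel]

theorem hasDerivAt_exp_const_mul (a s : ℝ) :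
    HasDerivAt (fun s => Real.exp (a * s)) (a * Real.exp (a * s)) s := by
  simpa only [mul_comm, id, one_mul, mul_one] using ((hasDerivAt_id s).const_mul a).exp

theorem hasDerivAt_integral_exp (a : ℝ) {f : ℝ → ℝ} (hf : Continuous f) (s : ℝ) :
    HasDerivAt (fun s => ∫ r in (0 : ℝ)..s, Real.exp (-(a * r)) * f r)
      (Real.exp (-(a * s)) * f s) s := by
  have hc : Continuous fun r => Real.exp (-(a * r)) * f r := by fun_prop
  exact intervalIntegral.integral_hasDerivAt_right (hc.intervalIntegrable _ _)
    (hc.stronglyMeasurableAtFilter _ _) hc.continuousAt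

theorem hasDerivAt_duhamel (a : ℝ) {f : ℝ → ℝ} (hf : Continuous f) (s : ℝ) :
    HasDerivAt (duhamel a f) (a * duhamel a f s + f s) s := by
  refine ((hasDerivAt_exp_const_mul a s).mul (hasDerivAt_integral_exp a hf s)).congr_deriv ?_
  rw [← mul_assoc (Real.exp (a * s)), ← Real.exp_add, add_neg_cancel, Real.exp_zero, one_mul,
    duhamel, mul_assoc]

theorem contDiff_duhamel (a : ℝ) {f : ℝ → ℝ} (hf : ContDiff ℝ ∞ f) :
    ContDiff ℝ ∞ (duhamel a f) := by
  have h := hasDerivAt_integral_exp a hf.continuous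
  refine ContDiff.mul (by fun_prop)
    (contDiff_infty_iff_deriv.2 ⟨fun s => (h s).differentiableAt, ?_⟩)
  rw [funext fun s => (h s).deriv]
  fun_prop

/-- The velocity shift `k` in the flow of `field c`. -/
def flowK (c : Fin 5 → ℝ) : ℝ → ℝ := duhamel (c 4 - c 3) fun _ => c 2

/-- The time shift `t₀` in the flow of `field c`. -/
def flowT (c : Fin 5 → ℝ) : ℝ → ℝ := duhamel (c 3) fun _ => c 0

/-- The space shift `x₀` in the flow of `field c`. -/
def flowX (c : Fin 5 → ℝ) : ℝ → ℝ := duhamel (c 4) fun r => c 2 * flowT c r + c 1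

/-- The flow of `field c`, see `hasDerivAt_flow`. -/
def flow (c : Fin 5 → ℝ) (s : ℝ) : Similarity where
  τ := Units.mk0 (Real.exp (c 3 * s)) (Real.exp_ne_zero _)
  b := Units.mk0 (Real.exp ((c 4 - c 3) * s)) (Real.exp_ne_zero _)
  k := flowK c s
  t₀ := flowT c s
  x₀ := flowX c s

@[fun_prop]
theorem contDiff_flowK (c : Fin 5 → ℝ) : ContDiff ℝ ∞ (flowK c) :=
  contDiff_duhamel _ contDiff_const

@[fun_prop]
theorem contDiff_flowT (c : Fin 5 → ℝ) : ContDiff ℝ ∞ (flowT c) :=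
  contDiff_duhamel _ contDiff_const

@[fun_prop]
theorem contDiff_flowX (c : Fin 5 → ℝ) : ContDiff ℝ ∞ (flowX c) :=
  contDiff_duhamel _ (by fun_prop)

theorem flow_zero (c : Fin 5 → ℝ) : flow c 0 = 1 := by
  ext <;> simp [flow, flowK, flowT, flowX, duhamel_at_zero, Similarity.one_def]

theorem hasDerivAt_flow (c : Fin 5 → ℝ) (y : Total) (s : ℝ) :
    HasDerivAt (fun s => (flow c s).act y) (field c ((flow c s).act y)) s := by
  have hX : HasDerivAt (flowX c) (c 4 * flowX c s + (c 2 * flowT c s + c 1)) s :=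
    hasDerivAt_duhamel _ (((contDiff_flowT c).continuous.const_mul _).add continuous_const) s
  have h := Similarity.hasDerivAt_act (f := flow c) (hasDerivAt_exp_const_mul (c 3) s)
    (hasDerivAt_exp_const_mul (c 4 - c 3) s) (hasDerivAt_duhamel _ continuous_const s)
    (hasDerivAt_duhamel _ continuous_const s) hX y
  refine h.congr_deriv ?_
  apply total_ext <;> simp [field, Similarity.act, Similarity.base, flow, flowK, flowT] <;> ring

theorem exists_lipschitzWith_field (c : Fin 5 → ℝ) : ∃ K, LipschitzWith K (field c) := by
  let L : Total →ₗ[ℝ] Total :=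
    { toFun := fun y => field c y - field c 0
      map_add' := fun y y' => by apply total_ext <;> simp [field] <;> ring
      map_smul' := fun r y => by apply total_ext <;> simp [field] <;> ring }
  refine ⟨‖L.toContinuousLinearMap‖₊, fun y y' => ?_⟩
  have h := L.toContinuousLinearMap.lipschitz y y'
  rwa [LinearMap.coe_toContinuousLinearMap', LinearMap.coe_mk, AddHom.coe_mk,
    edist_sub_right] at h

theorem isTimeOneMap_field_iff {c : Fin 5 → ℝ} {σ : Equiv.Perm Total} :
    IsTimeOneMap (field c) σ ↔ σ = (flow c 1).toPerm := by
  refine ⟨fun h => Equiv.ext fun y => ?_, ?_⟩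
  · obtain ⟨γ, h0, hγ, h1⟩ := h y
    obtain ⟨K, hK⟩ := exists_lipschitzWith_field c
    have hunique : γ = fun s => (flow c s).act y :=
      ODE_solution_unique_univ (v := fun _ => field c) (s := fun _ => Set.univ) (t₀ := 0)
        (fun _ => hK.lipschitzOnWith) (fun t => ⟨hγ t, trivial⟩)
        (fun t => ⟨hasDerivAt_flow c y t, trivial⟩)
        (by rw [h0, flow_zero, Similarity.act_one])
    rw [← h1, hunique, Similarity.toPerm_apply]
  · rintro rfl y
    exact ⟨fun s => (flow c s).act y, by simp only [flow_zero, Similarity.act_one],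
      hasDerivAt_flow c y, rfl⟩

/-! ### The groups of continuous and discrete transformations -/

namespace Similarity

/-- The similarities with positive scaling factors; they form the identity component. -/
def positive : Subgroup Similarity where
  carrier := {f | 0 < (f.τ : ℝ) ∧ 0 < (f.b : ℝ)}
  mul_mem' := fun hf hg => ⟨mul_pos hf.1 hg.1, mul_pos hf.2 hg.2⟩
  one_mem' := ⟨one_pos, one_pos⟩
  inv_mem' := fun {f} hf => by
    simpa only [inv_def, Set.mem_ofPred_eq, Units.val_inv_eq_inv_val, inv_pos] using hf

/-- The similarity with the given scaling factors which fixes the origin. -/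
def scaling (τ b : ℝˣ) : Similarity := ⟨τ, b, 0, 0, 0⟩

/-- The Galilean boost with velocity `k`. -/
def boost (k : ℝ) : Similarity := ⟨1, 1, k, 0, 0⟩

/-- The translation of `t` and `x`. -/
def translation (t₀ x₀ : ℝ) : Similarity := ⟨1, 1, 0, t₀, x₀⟩

theorem eq_translation_mul_boost_mul_scaling (f : Similarity) :
    f = translation f.t₀ f.x₀ * boost f.k * scaling f.τ f.b := by
  ext <;> simp [mul_def, translation, boost, scaling]

theorem translation_eq_flow (t₀ x₀ : ℝ) : translation t₀ x₀ = flow ![t₀, x₀, 0, 0, 0] 1 := by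
  ext <;> simp [translation, flow, flowK, flowT, flowX, duhamel_zero_left_const]

theorem boost_eq_flow (k : ℝ) : boost k = flow ![0, 0, k, 0, 0] 1 := by
  ext <;> simp [boost, flow, flowK, flowT, flowX, duhamel_zero_left_const]

theorem scaling_eq_flow {τ b : ℝˣ} (hτ : 0 < (τ : ℝ)) (hb : 0 < (b : ℝ)) :
    scaling τ b = flow ![0, 0, 0, Real.log τ, Real.log τ + Real.log b] 1 := by
  ext <;> simp [scaling, flow, flowK, flowT, flowX, duhamel_zero_right, Real.exp_log hτ,
    Real.exp_log hb]

theorem scaling_mul_scaling (τ b τ' b' : ℝˣ) :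
    scaling τ b * scaling τ' b' = scaling (τ * τ') (b * b') := by
  ext <;> simp [mul_def, scaling]

end Similarity

open Similarity

theorem flow_mem_positive (c : Fin 5 → ℝ) (s : ℝ) : flow c s ∈ positive :=
  ⟨Real.exp_pos _, Real.exp_pos _⟩

theorem toPerm_flow_one_mem_continuousGroup (c : Fin 5 → ℝ) :
    toPerm (flow c 1) ∈ continuousGroup :=
  Subgroup.subset_closure ⟨field c, mem_fieldSpan_iff.2 ⟨c, rfl⟩, isTimeOneMap_field_iff.2 rfl⟩

theorem continuousGroup_eq : continuousGroup = positive.map toPerm := by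
  apply le_antisymm
  · rw [continuousGroup, Subgroup.closure_le]
    rintro σ ⟨v, hv, hσ⟩
    obtain ⟨c, rfl⟩ := mem_fieldSpan_iff.1 hv
    exact ⟨flow c 1, flow_mem_positive c 1, (isTimeOneMap_field_iff.1 hσ).symm⟩
  · rintro _ ⟨f, hf, rfl⟩
    rw [f.eq_translation_mul_boost_mul_scaling, translation_eq_flow, boost_eq_flow,
      scaling_eq_flow hf.1 hf.2, map_mul, map_mul]
    exact mul_mem (mul_mem (toPerm_flow_one_mem_continuousGroup _)
      (toPerm_flow_one_mem_continuousGroup _)) (toPerm_flow_one_mem_continuousGroup _)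

theorem toPerm_mem_continuousGroup_iff {f : Similarity} :
    toPerm f ∈ continuousGroup ↔ 0 < (f.τ : ℝ) ∧ 0 < (f.b : ℝ) := by
  rw [continuousGroup_eq]
  exact Subgroup.mem_map_iff_mem toPerm_injective

theorem discrete₁_eq : discrete₁ = toPerm (scaling (-1) 1) := by
  ext y : 1
  apply total_ext <;> simp [act, base, scaling, discrete₁, Function.Involutive.toPerm]

theorem discrete₂_eq : discrete₂ = toPerm (scaling (-1) (-1)) := by
  ext y : 1
  apply total_ext <;> simp [act, base, scaling, discrete₂, Function.Involutive.toPerm]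

theorem discrete₁_mul_discrete₂_eq : discrete₁ * discrete₂ = toPerm (scaling 1 (-1)) := by
  rw [discrete₁_eq, discrete₂_eq, ← map_mul, scaling_mul_scaling, neg_one_mul, neg_neg, one_mul]

theorem discrete₁_notMem_continuousGroup : discrete₁ ∉ continuousGroup := by
  rw [discrete₁_eq, toPerm_mem_continuousGroup_iff]
  norm_num [scaling]

theorem discrete₂_notMem_continuousGroup : discrete₂ ∉ continuousGroup := by
  rw [discrete₂_eq, toPerm_mem_continuousGroup_iff]
  norm_num [scaling]

theorem discrete₁_mul_discrete₂_notMem_continuousGroup :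
    discrete₁ * discrete₂ ∉ continuousGroup := by
  rw [discrete₁_mul_discrete₂_eq, toPerm_mem_continuousGroup_iff]
  norm_num [scaling]

theorem toPerm_mem_generatedGroup (f : Similarity) : toPerm f ∈ generatedGroup := by
  have hd₁ : discrete₁ ∈ generatedGroup :=
    Subgroup.mem_sup_right (Subgroup.subset_closure (Or.inl rfl))
  have hd₂ : discrete₂ ∈ generatedGroup :=
    Subgroup.mem_sup_right (Subgroup.subset_closure (Or.inr rfl))
  have hpos : ∀ g : Similarity, 0 < (g.τ : ℝ) → 0 < (g.b : ℝ) → toPerm g ∈ generatedGroup :=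
    fun g hτ hb => Subgroup.mem_sup_left (toPerm_mem_continuousGroup_iff.2 ⟨hτ, hb⟩)
  have hmul : ∀ ε δ : ℝˣ, toPerm (scaling ε δ) ∈ generatedGroup → 0 < (f.τ * ε : ℝ) →
      0 < (f.b * δ : ℝ) → toPerm f ∈ generatedGroup := fun ε δ hd hτ hb =>
    (Subgroup.mul_mem_cancel_right _ hd).1 (by rw [← map_mul]; exact hpos _ hτ hb)
  rcases lt_or_gt_of_ne f.τ.ne_zero with hτ | hτ <;> rcases lt_or_gt_of_ne f.b.ne_zero with hb | hb
  · exact hmul (-1) (-1) (discrete₂_eq ▸ hd₂) (by simpa using hτ) (by simpa using hb)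
  · exact hmul (-1) 1 (discrete₁_eq ▸ hd₁) (by simpa using hτ) (by simpa using hb)
  · exact hmul 1 (-1) (discrete₁_mul_discrete₂_eq ▸ mul_mem hd₁ hd₂) (by simpa using hτ)
      (by simpa using hb)
  · exact hpos f hτ hb

theorem generatedGroup_eq : generatedGroup = toPerm.range := by
  apply le_antisymm
  · rw [generatedGroup, continuousGroup_eq, sup_le_iff, Subgroup.closure_le]
    refine ⟨Subgroup.map_le_range _ _, ?_⟩
    rintro σ (rfl | rfl)
    exacts [⟨_, discrete₁_eq.symm⟩, ⟨_, discrete₂_eq.symm⟩]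
  · rintro _ ⟨f, rfl⟩
    exact toPerm_mem_generatedGroup f

/-! ### Prolongation of similarities -/

theorem continuous_toBase : Continuous toBase :=
  continuous_pi fun i => by fin_cases i <;> exact continuous_apply _

theorem toBase_prolong (g : Base → Base) (j : Jet) : toBase (prolong g j) = g (toBase j) :=
  base_ext rfl rfl rfl rfl

theorem totalT_congr {A B : Jet → ℝ} {j : Jet} (h : A =ᶠ[𝓝 j] B) :
    totalT A =ᶠ[𝓝 j] totalT B := by
  filter_upwards [h.fderiv (𝕜 := ℝ)] with j' hj'
  rw [totalT, totalT, hj']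

theorem totalX_congr {A B : Jet → ℝ} {j : Jet} (h : A =ᶠ[𝓝 j] B) :
    totalX A =ᶠ[𝓝 j] totalX B := by
  filter_upwards [h.fderiv (𝕜 := ℝ)] with j' hj'
  rw [totalX, totalX, hj']

section Congr

variable {g g' : Base → Base} {j : Jet} (h : g =ᶠ[𝓝 (toBase j)] g')

include h

theorem comp_congr (i : Fin 4) : comp g i =ᶠ[𝓝 j] comp g' i := by
  filter_upwards [continuous_toBase.continuousAt.eventually h] with j' hj'
  rw [comp, comp, hj']

theorem jac_congr : jac g =ᶠ[𝓝 j] jac g' := by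
  filter_upwards [totalT_congr (comp_congr h 0), totalT_congr (comp_congr h 1),
    totalX_congr (comp_congr h 0), totalX_congr (comp_congr h 1)] with j' ht0 ht1 hx0 hx1
  rw [jac, jac, ht0, ht1, hx0, hx1]

theorem newT_congr {A B : Jet → ℝ} (hA : A =ᶠ[𝓝 j] B) : newT g A =ᶠ[𝓝 j] newT g' B := by
  filter_upwards [totalT_congr (comp_congr h 1), totalX_congr (comp_congr h 1), jac_congr h,
    totalT_congr hA, totalX_congr hA] with j' ht1 hx1 hjac htA hxA
  rw [newT, newT, ht1, hx1, hjac, htA, hxA]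

theorem newX_congr {A B : Jet → ℝ} (hA : A =ᶠ[𝓝 j] B) : newX g A =ᶠ[𝓝 j] newX g' B := by
  filter_upwards [totalT_congr (comp_congr h 0), totalX_congr (comp_congr h 0), jac_congr h,
    totalT_congr hA, totalX_congr hA] with j' ht0 hx0 hjac htA hxA
  rw [newX, newX, ht0, hx0, hjac, htA, hxA]

theorem prolong_congr : prolong g j = prolong g' j := by
  have hu := comp_congr h 2
  have hh := comp_congr h 3
  have hut := newT_congr h hu
  have hux := newX_congr h hu
  have hht := newT_congr h hh
  have hhx := newX_congr h hh
  simp only [prolong, (comp_congr h 0).eq_of_nhds, (comp_congr h 1).eq_of_nhds, hu.eq_of_nhds,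
    hh.eq_of_nhds, hut.eq_of_nhds, hux.eq_of_nhds, hht.eq_of_nhds, hhx.eq_of_nhds,
    (newT_congr h hut).eq_of_nhds, (newX_congr h hut).eq_of_nhds, (newX_congr h hux).eq_of_nhds,
    (newT_congr h hht).eq_of_nhds, (newX_congr h hht).eq_of_nhds, (newX_congr h hhx).eq_of_nhds]

end Congr

theorem fderiv_affine {ι : Type*} [Finite ι] (i l : ι) (α β γ : ℝ) (j v : ι → ℝ) :
    fderiv ℝ (fun j : ι → ℝ => α * j i + β * j l + γ) j v = α * v i + β * v l := by
  have := Fintype.ofFinite ι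
  have h : HasFDerivAt (fun j : ι → ℝ => α * j i + β * j l + γ)
      (α • ContinuousLinearMap.proj (R := ℝ) (φ := fun _ : ι => ℝ) i +
        β • ContinuousLinearMap.proj (R := ℝ) (φ := fun _ : ι => ℝ) l) j :=
    (((hasFDerivAt_apply i j).const_mul α).add ((hasFDerivAt_apply l j).const_mul β)).add_const γ
  rw [h.fderiv]
  rfl

namespace Similarity

theorem comp_base_zero (f : Similarity) :
    comp f.base 0 = fun j => f.τ * j 0 + 0 * j 0 + f.t₀ := by
  funext j
  simp [comp, base, toBase]

theorem comp_base_one (f : Similarity) :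
    comp f.base 1 = fun j => f.τ * f.b * j 1 + f.τ * f.k * j 0 + f.x₀ := rfl

theorem comp_base_two (f : Similarity) : comp f.base 2 = fun j => f.b * j 2 + 0 * j 0 + f.k := by
  funext j
  simp [comp, base, toBase]

theorem comp_base_three (f : Similarity) :
    comp f.base 3 = fun j => (f.b : ℝ) ^ 2 * j 3 + 0 * j 0 + 0 := by
  funext j
  simp [comp, base, toBase]

theorem jac_base (f : Similarity) (j : Jet) : jac f.base j = (f.τ : ℝ) ^ 2 * f.b := by
  simp only [jac, totalT, totalX, comp_base_zero, comp_base_one, fderiv_affine, Matrix.cons_val]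
  ring

theorem newT_base (f : Similarity) (A : Jet → ℝ) (j : Jet) :
    newT f.base A j = (totalT A j - f.k / f.b * totalX A j) / f.τ := by
  rw [newT, jac_base]
  simp only [totalT, totalX, comp_base_one, fderiv_affine, Matrix.cons_val]
  field_simp
  ring

theorem newX_base (f : Similarity) (A : Jet → ℝ) (j : Jet) :
    newX f.base A j = totalX A j / (f.τ * f.b) := by
  rw [newX, jac_base]
  simp only [totalT, totalX, comp_base_zero, fderiv_affine, Matrix.cons_val]
  field_simp
  ring

theorem newT_base_two (f : Similarity) :
    newT f.base (comp f.base 2) = fun j => (f.b : ℝ) / f.τ * j 4 + -f.k / f.τ * j 5 + 0 := by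
  funext j
  rw [newT_base, comp_base_two]
  simp only [totalT, totalX, fderiv_affine, Matrix.cons_val]
  field_simp
  ring

theorem newX_base_two (f : Similarity) :
    newX f.base (comp f.base 2) = fun j => 1 / (f.τ : ℝ) * j 5 + 0 * j 0 + 0 := by
  funext j
  rw [newX_base, comp_base_two]
  simp only [totalX, fderiv_affine, Matrix.cons_val]
  field_simp
  ring

theorem newT_base_three (f : Similarity) : newT f.base (comp f.base 3) =
    fun j => (f.b : ℝ) ^ 2 / f.τ * j 6 + -(f.b * f.k) / f.τ * j 7 + 0 := by
  funext j
  rw [newT_base, comp_base_three]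
  simp only [totalT, totalX, fderiv_affine, Matrix.cons_val]
  field_simp
  ring

theorem newX_base_three (f : Similarity) :
    newX f.base (comp f.base 3) = fun j => (f.b : ℝ) / f.τ * j 7 + 0 * j 0 + 0 := by
  funext j
  rw [newX_base, comp_base_three]
  simp only [totalX, fderiv_affine, Matrix.cons_val]
  field_simp
  ring

/-- The action of a similarity on jets, see `Similarity.prolong_base`. -/
def actJet (f : Similarity) (j : Jet) : Jet :=
  ![f.τ * j 0 + f.t₀, f.τ * f.b * j 1 + f.τ * f.k * j 0 + f.x₀, f.b * j 2 + f.k, f.b ^ 2 * j 3,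
    (f.b * j 4 - f.k * j 5) / f.τ, j 5 / f.τ,
    (f.b ^ 2 * j 6 - f.b * f.k * j 7) / f.τ, f.b * j 7 / f.τ,
    (f.b * j 8 - 2 * f.k * j 9 + f.k ^ 2 / f.b * j 10) / f.τ ^ 2,
    (f.b * j 9 - f.k * j 10) / (f.τ ^ 2 * f.b), j 10 / (f.τ ^ 2 * f.b),
    (f.b ^ 2 * j 11 - 2 * f.b * f.k * j 12 + f.k ^ 2 * j 13) / f.τ ^ 2,
    (f.b * j 12 - f.k * j 13) / f.τ ^ 2, j 13 / f.τ ^ 2]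

theorem prolong_base (f : Similarity) : prolong f.base = f.actJet := by
  funext j
  simp only [prolong, newT_base_two, newX_base_two, newT_base_three, newX_base_three]
  simp only [newT_base, newX_base, totalT, totalX, fderiv_affine, comp_base_zero, comp_base_one,
    comp_base_two, comp_base_three, Matrix.cons_val]
  funext i
  fin_cases i <;> simp [actJet] <;> field_simp <;> ring

theorem inv_actJet_actJet (f : Similarity) (j : Jet) : f⁻¹.actJet (f.actJet j) = j := by
  funext i
  fin_cases i <;> simp [actJet, inv_def] <;> field_simp <;> ring

/-- The action of a similarity on the arguments `(h, u_x, h_x)` of the arbitrary element. -/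
def actArgs (f : Similarity) (y : Fin 3 → ℝ) : Fin 3 → ℝ :=
  ![f.b ^ 2 * y 0, y 1 / f.τ, f.b * y 2 / f.τ]

theorem args_actJet (f : Similarity) (j : Jet) : args (f.actJet j) = f.actArgs (args j) := rfl

theorem inv_actArgs_actArgs (f : Similarity) (y : Fin 3 → ℝ) : f⁻¹.actArgs (f.actArgs y) = y := by
  funext i
  fin_cases i <;> simp [actArgs, inv_def]
  field_simp

theorem contDiff_actArgs (f : Similarity) : ContDiff ℝ ∞ f.actArgs := by
  refine contDiff_pi.2 fun i => ?_
  fin_cases i <;> simp only [actArgs, Fin.reduceFinMk, Matrix.cons_val] <;> fun_prop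

/-- The arbitrary element to which a similarity maps a given one. -/
def mapElem (f : Similarity) (θ : ArbElem) : ArbElem where
  dom := f⁻¹.actArgs ⁻¹' θ.dom
  toFun y := f.τ * f.b ^ 2 * θ.toFun (f⁻¹.actArgs y)
  isOpen_dom := θ.isOpen_dom.preimage f⁻¹.contDiff_actArgs.continuous
  nonempty_dom := by
    obtain ⟨y, hy⟩ := θ.nonempty_dom
    exact ⟨f.actArgs y, by rwa [Set.mem_preimage, inv_actArgs_actArgs]⟩
  smooth := contDiffOn_const.mul (θ.smooth.comp f⁻¹.contDiff_actArgs.contDiffOn fun _ h => h)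

theorem actJet_mem_system_mapElem_iff (f : Similarity) (θ : ArbElem) (j : Jet) :
    f.actJet j ∈ system (f.mapElem θ) ↔ j ∈ system θ := by
  have momentum : f.actJet j 4 + f.actJet j 2 * f.actJet j 5 + f.actJet j 7 -
      f.τ * f.b ^ 2 * θ.toFun (args j) * f.actJet j 10 =
      f.b / f.τ * (j 4 + j 2 * j 5 + j 7 - θ.toFun (args j) * j 10) := by
    simp only [actJet, Matrix.cons_val]
    field_simp
    ring
  have mass : f.actJet j 6 + f.actJet j 2 * f.actJet j 7 + f.actJet j 3 * f.actJet j 5 =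
      f.b ^ 2 / f.τ * (j 6 + j 2 * j 7 + j 3 * j 5) := by
    simp only [actJet, Matrix.cons_val]
    field_simp
    ring
  simp [system, mapElem, args_actJet, inv_actArgs_actArgs, momentum, mass]

theorem actJet_mem_graph_mapElem_iff (f : Similarity) (θ : ArbElem) (m : ExtJet) :
    (f.actJet m.1, f.τ * f.b ^ 2 * m.2) ∈ graph (f.mapElem θ) ↔ m ∈ graph θ := by
  simp [graph, mapElem, args_actJet, inv_actArgs_actArgs]

theorem contDiff_base (f : Similarity) : ContDiff ℝ ∞ f.base := by
  refine contDiff_pi.2 fun i => ?_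
  fin_cases i <;> simp only [base, Fin.reduceFinMk, Matrix.cons_val] <;> fun_prop

theorem bijective_fderiv_base (f : Similarity) (z : Base) :
    Function.Bijective (fderiv ℝ f.base z) := by
  have hleft : ∀ (g : Similarity) (z v : Base),
      fderiv ℝ g⁻¹.base (g.base z) (fderiv ℝ g.base z v) = v := fun g z v => by
    have hd : ∀ (g : Similarity) (z : Base), DifferentiableAt ℝ g.base z := fun g z =>
      g.contDiff_base.contDiffAt.differentiableAt (by simp)
    have hid : g⁻¹.base ∘ g.base = id := funext fun z => by
      rw [Function.comp_apply, ← base_mul, inv_mul_cancel, base_one, id]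
    rw [← ContinuousLinearMap.comp_apply, ← fderiv_comp z (hd _ _) (hd _ _), hid, fderiv_id,
      ContinuousLinearMap.id_apply]
  refine Function.bijective_iff_has_inverse.2 ⟨_, hleft f z, fun v => ?_⟩
  have hright := hleft f⁻¹ (f.base z) v
  rwa [inv_inv, ← base_mul, inv_mul_cancel, base_one] at hright

end Similarity

/-- Closure of a class of arbitrary elements under the action of similarities. -/
def IsSimilarityInvariant (S : Set ArbElem) : Prop := ∀ f : Similarity, ∀ θ ∈ S, f.mapElem θ ∈ S

theorem isSimilarityInvariant_allElements : IsSimilarityInvariant allElements :=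
  fun _ _ _ => trivial

theorem isSimilarityInvariant_nonvanishingElements :
    IsSimilarityInvariant nonvanishingElements := fun f _ hθ _ hy =>
  mul_ne_zero (mul_ne_zero f.τ.ne_zero (pow_ne_zero 2 f.b.ne_zero)) (hθ _ hy)

theorem isOpen_cylinder {U : Set Base} {W : Set ℝ} (hU : IsOpen U) (hW : IsOpen W) :
    IsOpen (cylinder U W) :=
  (hU.preimage (continuous_toBase.comp continuous_fst)).inter (hW.preimage continuous_snd)

/-- `φ` acts over `U` and `W` as the similarity `f`. -/
structure ActsAs (φ : Transf) (f : Similarity) (U : Set Base) (W : Set ℝ) : Prop where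
  base_eqOn : Set.EqOn φ.base f.base U
  arb_eq : ∀ m ∈ φ.domain U W, φ.arb m = f.τ * f.b ^ 2 * m.2

namespace ActsAs

variable {φ : Transf} {f : Similarity} {U : Set Base} {W : Set ℝ} (h : ActsAs φ f U W)
  (hU : IsOpen U)

include h hU

theorem base_eventuallyEq {z : Base} (hz : z ∈ U) : φ.base =ᶠ[𝓝 z] f.base :=
  h.base_eqOn.eventuallyEq_of_mem (hU.mem_nhds hz)

theorem domain_eq : φ.domain U W = cylinder U W := by
  refine Set.sep_eq_self_iff_mem_true.2 fun m hm => ?_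
  rw [(jac_congr (h.base_eventuallyEq hU hm.1)).eq_of_nhds, f.jac_base]
  exact mul_ne_zero (pow_ne_zero 2 f.τ.ne_zero) f.b.ne_zero

theorem act_eq {m : ExtJet} (hm : m ∈ φ.domain U W) :
    φ.act m = (f.actJet m.1, f.τ * f.b ^ 2 * m.2) := by
  rw [Transf.act, prolong_congr (h.base_eventuallyEq hU hm.1.1), f.prolong_base, h.arb_eq m hm]

theorem total_eq {m : ExtJet} (hm : m ∈ cylinder U W) :
    ((φ.base (toBase m.1), φ.arb m) : Total) = f.act (toTotal m) :=
  Prod.ext (h.base_eqOn hm.1) (h.arb_eq m (by rwa [h.domain_eq hU]))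

theorem injOn_act : Set.InjOn φ.act (φ.domain U W) := by
  intro m hm m' hm' he
  rw [h.act_eq hU hm, h.act_eq hU hm', Prod.mk.injEq] at he
  refine Prod.ext ?_ (by simpa using he.2)
  rw [← f.inv_actJet_actJet m.1, he.1, f.inv_actJet_actJet]

theorem fderiv_arb (hW : IsOpen W) {m : ExtJet} (hm : m ∈ φ.domain U W) :
    fderiv ℝ φ.arb m (0, 1) = f.τ * f.b ^ 2 := by
  have hloc : φ.arb =ᶠ[𝓝 m] fun m => f.τ * f.b ^ 2 * m.2 := by
    have harb := h.arb_eq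
    rw [h.domain_eq hU] at hm harb
    exact Set.EqOn.eventuallyEq_of_mem harb ((isOpen_cylinder hU hW).mem_nhds hm)
  have hder : HasFDerivAt (fun m : ExtJet => (f.τ * f.b ^ 2 : ℝ) * m.2)
      ((f.τ * f.b ^ 2 : ℝ) • ContinuousLinearMap.snd ℝ Jet ℝ) m :=
    hasFDerivAt_snd.const_mul _
  rw [hloc.fderiv_eq, hder.fderiv]
  exact mul_one _

theorem image_graph (θ : ArbElem) : φ.act '' (graph θ ∩ φ.domain U W) =
    graph (f.mapElem θ) ∩ φ.act '' φ.domain U W := by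
  have hgraph : ∀ m ∈ φ.domain U W, φ.act m ∈ graph (f.mapElem θ) ↔ m ∈ graph θ :=
    fun m hm => by rw [h.act_eq hU hm, f.actJet_mem_graph_mapElem_iff]
  ext n
  constructor
  · rintro ⟨m, ⟨hm, hmd⟩, rfl⟩
    exact ⟨(hgraph m hmd).2 hm, m, hmd, rfl⟩
  · rintro ⟨hn, m, hmd, rfl⟩
    exact ⟨m, ⟨(hgraph m hmd).1 hn, hmd⟩, rfl⟩

theorem isEquivalenceTransformation {S : Set ArbElem} (hS : IsSimilarityInvariant S)
    (hW : IsOpen W) : IsEquivalenceTransformation S U W φ where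
  smooth_base := f.contDiff_base.contDiffOn.congr h.base_eqOn
  injOn_base := h.base_eqOn.injOn_iff.2 f.base_injective.injOn
  bijective_base z hz := by
    rw [(h.base_eventuallyEq hU hz).fderiv_eq]
    exact f.bijective_fderiv_base z
  smooth_arb := ContDiffOn.congr (ContDiff.contDiffOn (by fun_prop)) h.arb_eq
  injOn_act := h.injOn_act hU
  deriv_arb m hm := by
    rw [h.fderiv_arb hU hW hm]
    exact mul_ne_zero f.τ.ne_zero (pow_ne_zero 2 f.b.ne_zero)
  maps_class θ hθ := by
    refine ⟨f.mapElem θ, hS f θ hθ, h.image_graph hU θ, fun m hm => ?_⟩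
    rw [prolong_congr (h.base_eventuallyEq hU hm.2.1.1), f.prolong_base,
      f.actJet_mem_system_mapElem_iff]

end ActsAs

/-! ### Total derivatives in terms of the Jacobian matrix -/

/-- The partial derivative with respect to the `k`-th of the coordinates `(t, x, u, h)`. -/
def pd (k : Fin 4) (f : Base → ℝ) (z : Base) : ℝ := fderiv ℝ f z (Pi.single k 1)

/-- The Jacobian matrix of a transformation of `(t, x, u, h)`. -/
def grad (g : Base → Base) (z : Base) : Matrix (Fin 4) (Fin 4) ℝ :=
  Matrix.of fun i k => pd k (fun z => g z i) z

theorem grad_apply (g : Base → Base) (z : Base) (i k : Fin 4) :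
    grad g z i k = pd k (fun z => g z i) z := rfl

theorem fderiv_eq_sum_pd (f : Base → ℝ) (z v : Base) :
    fderiv ℝ f z v = ∑ k, v k * pd k f z := by
  conv_lhs => rw [pi_eq_sum_univ' v, map_sum]
  exact Finset.sum_congr rfl fun k _ => (fderiv ℝ f z).map_smul _ _

theorem isUnit_grad {g : Base → Base} {z : Base} (hg : DifferentiableAt ℝ g z)
    (hbij : Function.Bijective (fderiv ℝ g z)) : IsUnit (grad g z) := by
  have hgrad : grad g z = LinearMap.toMatrix' (fderiv ℝ g z : Base →ₗ[ℝ] Base) := by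
    ext i k
    rw [grad_apply, pd, (hasFDerivAt_pi'.1 hg.hasFDerivAt i).fderiv, LinearMap.toMatrix'_apply]
    rfl
  rw [hgrad, LinearMap.isUnit_toMatrix'_iff, Module.End.isUnit_iff]
  exact hbij

/-- `toBase` as a continuous linear map. -/
def toBaseL : Jet →L[ℝ] Base :=
  ContinuousLinearMap.pi fun i => ContinuousLinearMap.proj (R := ℝ) (φ := fun _ : Fin 14 => ℝ)
    (Fin.castLE (by norm_num) i)

theorem toBaseL_apply (j : Jet) : toBaseL j = toBase j := base_ext rfl rfl rfl rfl

theorem fderiv_comp_eq_sum_grad {g : Base → Base} {j : Jet} (hg : DifferentiableAt ℝ g (toBase j))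
    (i : Fin 4) (v : Jet) :
    fderiv ℝ (comp g i) j v = ∑ k, toBase v k * grad g (toBase j) i k := by
  have hi : HasFDerivAt (fun z => g z i) (fderiv ℝ (fun z => g z i) (toBase j)) (toBaseL j) := by
    rw [toBaseL_apply]
    exact (differentiableAt_pi.1 hg i).hasFDerivAt
  have hcomp : comp g i = (fun z => g z i) ∘ toBaseL :=
    funext fun j => by rw [Function.comp_apply, toBaseL_apply, comp]
  rw [hcomp, (hi.comp j toBaseL.hasFDerivAt).fderiv, ContinuousLinearMap.comp_apply,
    toBaseL_apply, fderiv_eq_sum_pd]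
  rfl

/-- The total derivative `D_t` of the `i`-th component of a transformation with Jacobian matrix
`A`, at a jet with `u_t = p` and `h_t = r`. -/
def alongT (A : Matrix (Fin 4) (Fin 4) ℝ) (p r : ℝ) (i : Fin 4) : ℝ :=
  A i 0 + p * A i 2 + r * A i 3

/-- The total derivative `D_x` of the `i`-th component of a transformation with Jacobian matrix
`A`, at a jet with `u_x = q` and `h_x = s`. -/
def alongX (A : Matrix (Fin 4) (Fin 4) ℝ) (q s : ℝ) (i : Fin 4) : ℝ :=
  A i 1 + q * A i 2 + s * A i 3

/-- The numerator of the new derivative, with respect to `x'`, of the `i`-th component of a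
transformation with Jacobian matrix `A`. For `i = 1` it is the determinant `jac`. -/
def minorX (A : Matrix (Fin 4) (Fin 4) ℝ) (p q r s : ℝ) (i : Fin 4) : ℝ :=
  alongT A p r 0 * alongX A q s i - alongX A q s 0 * alongT A p r i

section TotalDerivatives

variable {g : Base → Base} {j : Jet} (hg : DifferentiableAt ℝ g (toBase j))

include hg

theorem totalT_comp (i : Fin 4) :
    totalT (comp g i) j = alongT (grad g (toBase j)) (j 4) (j 6) i := by
  rw [totalT, fderiv_comp_eq_sum_grad hg, Fin.sum_univ_four]
  simp [toBase, alongT]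

theorem totalX_comp (i : Fin 4) :
    totalX (comp g i) j = alongX (grad g (toBase j)) (j 5) (j 7) i := by
  rw [totalX, fderiv_comp_eq_sum_grad hg, Fin.sum_univ_four]
  simp [toBase, alongX]

theorem jac_eq_minorX : jac g j = minorX (grad g (toBase j)) (j 4) (j 5) (j 6) (j 7) 1 := by
  simp only [jac, totalT_comp hg, totalX_comp hg, minorX]

theorem newX_comp_eq_minorX_div (i : Fin 4) :
    newX g (comp g i) j = minorX (grad g (toBase j)) (j 4) (j 5) (j 6) (j 7) i / jac g j := by
  simp only [newX, totalT_comp hg, totalX_comp hg, minorX]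

end TotalDerivatives

/-- The jet over `z` with `u_t = p`, `u_x = q`, `h_t = r`, `h_x = s`, `u_xx = w`, `h_xx = y`, the
other second derivatives being zero. -/
def jet (z : Base) (p q r s w y : ℝ) : Jet :=
  ![z 0, z 1, z 2, z 3, p, q, r, s, 0, 0, w, 0, 0, y]

@[simp]
theorem toBase_jet (z : Base) (p q r s w y : ℝ) : toBase (jet z p q r s w y) = z :=
  base_ext rfl rfl rfl rfl

theorem jac_jet {g : Base → Base} {z : Base} (hg : DifferentiableAt ℝ g z) (p q r s w y : ℝ) :
    jac g (jet z p q r s w y) = minorX (grad g z) p q r s 1 := by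
  rw [jac_eq_minorX (by rwa [toBase_jet]), toBase_jet]
  rfl

theorem newX_comp_jet {g : Base → Base} {z : Base} (hg : DifferentiableAt ℝ g z) (i : Fin 4)
    (p q r s w y : ℝ) : newX g (comp g i) (jet z p q r s w y) =
      minorX (grad g z) p q r s i / minorX (grad g z) p q r s 1 := by
  rw [newX_comp_eq_minorX_div (by rwa [toBase_jet]), jac_jet hg, toBase_jet]
  rfl

theorem args_prolong (g : Base → Base) (j : Jet) :
    args (prolong g j) = ![g (toBase j) 3, newX g (comp g 2) j, newX g (comp g 3) j] := rfl

theorem exists_minorX_one_ne_zero {A : Matrix (Fin 4) (Fin 4) ℝ}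
    (hA : LinearIndependent ℝ A.row) : ∃ p q r s, minorX A p q r s 1 ≠ 0 := by
  by_contra! hJ
  simp only [minorX, alongT, alongX] at hJ
  have m01 : A 0 0 * A 1 1 = A 0 1 * A 1 0 := by linear_combination hJ 0 0 0 0
  have m21 : A 0 2 * A 1 1 = A 0 1 * A 1 2 := by linear_combination hJ 1 0 0 0 - hJ 0 0 0 0
  have m31 : A 0 3 * A 1 1 = A 0 1 * A 1 3 := by linear_combination hJ 0 0 1 0 - hJ 0 0 0 0
  have m02 : A 0 0 * A 1 2 = A 0 2 * A 1 0 := by linear_combination hJ 0 1 0 0 - hJ 0 0 0 0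
  have m03 : A 0 0 * A 1 3 = A 0 3 * A 1 0 := by linear_combination hJ 0 0 0 1 - hJ 0 0 0 0
  have m23 : A 0 2 * A 1 3 = A 0 3 * A 1 2 := by
    linear_combination hJ 1 0 0 1 - hJ 1 0 0 0 - hJ 0 0 0 1 + hJ 0 0 0 0
  refine hA.ne_zero 0 (funext fun l => ?_)
  have hrow := Fintype.linearIndependent_iff.1 hA ![A 1 l, -A 0 l, 0, 0] (funext fun k => by
    rw [Fin.sum_univ_four]
    fin_cases l <;> fin_cases k <;> simp <;> linarith) 1
  exact neg_eq_zero.1 hrow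

/-- The velocities `u_t`, `u_x` are changed in such a way that the direction
`(D_t t') D_x - (D_x t') D_t` of differentiation with respect to `x'` stays the same. -/
theorem minorX_add_mul (A : Matrix (Fin 4) (Fin 4) ℝ) (p q r s ε : ℝ) (i : Fin 4) :
    minorX A (p + ε * alongT A p r 0) (q + ε * alongX A q s 0) r s i =
      (1 + ε * A 0 2) * minorX A p q r s i := by
  simp only [minorX, alongT, alongX]
  ring

theorem eq_zero_of_analytic {E : Type*} [NormedAddCommGroup E] [NormedSpace ℝ E] {f J : E → ℝ}
    (hf : ContDiff ℝ ω f) (hJ : Continuous J) {v₀ : E} (hv₀ : J v₀ ≠ 0)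
    (h : ∀ v, J v ≠ 0 → f v = 0) (v : E) : f v = 0 := by
  have hloc : f =ᶠ[𝓝 v₀] fun _ => 0 := by
    filter_upwards [hJ.continuousAt.eventually_ne hv₀] with v hv using h v hv
  exact congrFun
    ((contDiff_omega_iff_analyticOnNhd.1 hf).eq_of_eventuallyEq analyticOnNhd_const hloc) v

/-! ### Mapping constant arbitrary elements -/

/-- The constant arbitrary element on an open set. -/
def constElem (c : ℝ) {D : Set (Fin 3 → ℝ)} (hD : IsOpen D) (hne : D.Nonempty) : ArbElem where
  dom := D
  toFun _ := c
  isOpen_dom := hD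
  nonempty_dom := hne
  smooth := contDiffOn_const

/-- The class contains the nonzero constants on all nonempty open sets, which serve as test
elements. -/
def HasNonzeroConstants (S : Set ArbElem) : Prop :=
  ∀ c ≠ 0, ∀ D : Set (Fin 3 → ℝ), ∀ (hD : IsOpen D) (hne : D.Nonempty), constElem c hD hne ∈ S

theorem hasNonzeroConstants_allElements : HasNonzeroConstants allElements :=
  fun _ _ _ _ _ => trivial

theorem hasNonzeroConstants_nonvanishingElements : HasNonzeroConstants nonvanishingElements :=
  fun _ hc _ _ _ _ _ => hc

namespace IsEquivalenceTransformation

variable {S : Set ArbElem} {U : Set Base} {W : Set ℝ} {φ : Transf}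
  (h : IsEquivalenceTransformation S U W φ)

include h

theorem differentiableAt_base (hU : IsOpen U) {z : Base} (hz : z ∈ U) :
    DifferentiableAt ℝ φ.base z :=
  (h.smooth_base.contDiffAt (hU.mem_nhds hz)).differentiableAt (by simp)

theorem isUnit_grad_base (hU : IsOpen U) {z : Base} (hz : z ∈ U) : IsUnit (grad φ.base z) :=
  isUnit_grad (h.differentiableAt_base hU hz) (h.bijective_base z hz)

theorem linearIndependent_row (hU : IsOpen U) {z : Base} (hz : z ∈ U) :
    LinearIndependent ℝ (grad φ.base z).row :=
  Matrix.linearIndependent_rows_iff_isUnit.2 (h.isUnit_grad_base hU hz)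

variable (hS : HasNonzeroConstants S)

include hS

theorem exists_arb_eq {c : ℝ} (hc : c ∈ W) (hc0 : c ≠ 0) :
    ∃ f : (Fin 3 → ℝ) → ℝ, ∀ j, toBase j ∈ U → jac φ.base j ≠ 0 →
      φ.arb (j, c) = f (args (prolong φ.base j)) ∧
      (j 4 + j 2 * j 5 + j 7 - c * j 10 = 0 → j 6 + j 2 * j 7 + j 3 * j 5 = 0 →
        prolong φ.base j 4 + prolong φ.base j 2 * prolong φ.base j 5 + prolong φ.base j 7 -
          f (args (prolong φ.base j)) * prolong φ.base j 10 = 0 ∧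
        prolong φ.base j 6 + prolong φ.base j 2 * prolong φ.base j 7 +
          prolong φ.base j 3 * prolong φ.base j 5 = 0) := by
  obtain ⟨θ', -, hgraph, hsystem⟩ := h.maps_class _
    (hS c hc0 Set.univ isOpen_univ Set.univ_nonempty)
  refine ⟨θ'.toFun, fun j hj hjac => ?_⟩
  have hm : ((j, c) : ExtJet) ∈ graph (constElem c isOpen_univ Set.univ_nonempty) ∩
      φ.domain U W := ⟨⟨trivial, rfl⟩, ⟨hj, hc⟩, hjac⟩
  have himage := Set.mem_image_of_mem φ.act hm
  rw [hgraph] at himage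
  exact ⟨himage.1.2, fun hmom hmass => ((hsystem _ hm).1 ⟨trivial, hmom, hmass⟩).2⟩

variable (hW : ∃ c ∈ W, c ≠ 0)

include hW

theorem args_eq_of_args_prolong_eq {j j' : Jet} (hj : toBase j ∈ U) (hjac : jac φ.base j ≠ 0)
    (hj' : toBase j' ∈ U) (hjac' : jac φ.base j' ≠ 0)
    (he : args (prolong φ.base j) = args (prolong φ.base j')) : args j = args j' := by
  by_contra hne
  obtain ⟨c, hc, hc0⟩ := hW
  obtain ⟨θ', -, hgraph, -⟩ := h.maps_class _
    (hS c hc0 {args j'}ᶜ isClosed_singleton.isOpen_compl ⟨args j, hne⟩)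
  obtain ⟨f, hf⟩ := h.exists_arb_eq hS hc hc0
  have hm' : ((j', c) : ExtJet) ∈ φ.domain U W := ⟨⟨hj', hc⟩, hjac'⟩
  have hact : φ.act (j, c) ∈ graph θ' ∩ φ.act '' φ.domain U W := by
    rw [← hgraph]
    exact ⟨(j, c), ⟨⟨hne, rfl⟩, ⟨hj, hc⟩, hjac⟩, rfl⟩
  have hact' : φ.act (j', c) ∈ graph θ' ∩ φ.act '' φ.domain U W := by
    refine ⟨?_, _, hm', rfl⟩
    have hmem := hact.1
    simp only [graph, Transf.act, Set.mem_ofPred_eq] at hmem ⊢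
    rwa [(hf j' hj' hjac').1, ← he, ← (hf j hj hjac).1]
  rw [← hgraph] at hact'
  obtain ⟨m, ⟨hm, hmd⟩, hmact⟩ := hact'
  rw [h.injOn_act hmd hm' hmact] at hm
  exact hm.1 rfl

variable (hU : IsOpen U) {z : Base} (hz : z ∈ U)

include hU hz

theorem alongX_zero_eq_zero {p q r s : ℝ} (hJ : minorX (grad φ.base z) p q r s 1 ≠ 0) :
    alongX (grad φ.base z) q s 0 = 0 := by
  have hd := h.differentiableAt_base hU hz
  set A := grad φ.base z
  obtain ⟨ε, hε, hε'⟩ : ∃ ε : ℝ, ε ≠ 0 ∧ 1 + ε * A 0 2 ≠ 0 := by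
    by_cases h02 : A 0 2 = -1
    · exact ⟨-1, by norm_num, by rw [h02]; norm_num⟩
    · exact ⟨1, one_ne_zero, fun h0 => h02 (by linarith)⟩
  set P := p + ε * alongT A p r 0
  set Q := q + ε * alongX A q s 0 with hQ
  have hJ' : minorX A P Q r s 1 ≠ 0 := by
    rw [minorX_add_mul]
    exact mul_ne_zero hε' hJ
  have hnewX (i : Fin 4) : newX φ.base (comp φ.base i) (jet z p q r s 0 0) =
      newX φ.base (comp φ.base i) (jet z P Q r s 0 0) := by
    rw [newX_comp_jet hd, newX_comp_jet hd, minorX_add_mul, minorX_add_mul,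
      mul_div_mul_left _ _ hε']
  have hargs := h.args_eq_of_args_prolong_eq hS hW (j := jet z p q r s 0 0)
    (j' := jet z P Q r s 0 0) (by rwa [toBase_jet]) (by rwa [jac_jet hd]) (by rwa [toBase_jet])
    (by rwa [jac_jet hd])
    (by rw [args_prolong, args_prolong, hnewX, hnewX, toBase_jet, toBase_jet])
  have hqQ : q = Q := congrFun hargs 1
  exact (mul_eq_zero.1 (by linear_combination hQ - hqQ : ε * alongX A q s 0 = 0)).resolve_left hε

theorem grad_time_eq_zero {k : Fin 4} (hk : k ≠ 0) : grad φ.base z 0 k = 0 := by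
  obtain ⟨p, q, r, s, hne⟩ := exists_minorX_one_ne_zero (h.linearIndependent_row hU hz)
  have hX := eq_zero_of_analytic (E := ℝ × ℝ × ℝ × ℝ) (v₀ := (p, q, r, s))
    (f := fun v => alongX (grad φ.base z) v.2.1 v.2.2.2 0)
    (J := fun v => minorX (grad φ.base z) v.1 v.2.1 v.2.2.1 v.2.2.2 1)
    (by unfold alongX; fun_prop) (by unfold minorX alongX alongT; fun_prop) hne
    fun v hv => h.alongX_zero_eq_zero hS hW hU hz hv
  have h00 := hX (0, 0, 0, 0)
  have h10 := hX (0, 1, 0, 0)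
  have h01 := hX (0, 0, 0, 1)
  simp only [alongX] at h00 h10 h01
  fin_cases k
  · exact absurd rfl hk
  all_goals simp only [Fin.reduceFinMk]; linarith

theorem grad_time_ne_zero : grad φ.base z 0 0 ≠ 0 := fun h0 =>
  (h.linearIndependent_row hU hz).ne_zero 0 (funext fun k => by
    by_cases hk : k = 0
    · rwa [hk]
    · exact h.grad_time_eq_zero hS hW hU hz hk)

end IsEquivalenceTransformation

/-! ### The mass equation -/

namespace IsEquivalenceTransformation

variable {S : Set ArbElem} {U : Set Base} {W : Set ℝ} {φ : Transf}
  (h : IsEquivalenceTransformation S U W φ) (hS : HasNonzeroConstants S)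
  (hW : ∃ c ∈ W, c ≠ 0) (hU : IsOpen U)

section Jets

variable {j : Jet} (hj : toBase j ∈ U)

include h hS hW hU hj

theorem totalT_comp_zero : totalT (comp φ.base 0) j = grad φ.base (toBase j) 0 0 := by
  rw [totalT_comp (h.differentiableAt_base hU hj), alongT,
    h.grad_time_eq_zero hS hW hU hj (k := 2) (by decide),
    h.grad_time_eq_zero hS hW hU hj (k := 3) (by decide), mul_zero, mul_zero, add_zero, add_zero]

theorem totalX_comp_zero : totalX (comp φ.base 0) j = 0 := by
  rw [totalX_comp (h.differentiableAt_base hU hj), alongX,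
    h.grad_time_eq_zero hS hW hU hj (k := 1) (by decide),
    h.grad_time_eq_zero hS hW hU hj (k := 2) (by decide),
    h.grad_time_eq_zero hS hW hU hj (k := 3) (by decide), mul_zero, mul_zero, add_zero, add_zero]

theorem jac_eq_mul : jac φ.base j =
    grad φ.base (toBase j) 0 0 * alongX (grad φ.base (toBase j)) (j 5) (j 7) 1 := by
  rw [jac, h.totalT_comp_zero hS hW hU hj, h.totalX_comp_zero hS hW hU hj,
    totalX_comp (h.differentiableAt_base hU hj), zero_mul, sub_zero]

theorem newX_eq_div (B : Jet → ℝ) : newX φ.base B j =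
    totalX B j / alongX (grad φ.base (toBase j)) (j 5) (j 7) 1 := by
  rw [newX, h.totalT_comp_zero hS hW hU hj, h.totalX_comp_zero hS hW hU hj,
    h.jac_eq_mul hS hW hU hj, zero_mul, sub_zero,
    mul_div_mul_left _ _ (h.grad_time_ne_zero hS hW hU hj)]

theorem newX_comp_eq_div (i : Fin 4) : newX φ.base (comp φ.base i) j =
    alongX (grad φ.base (toBase j)) (j 5) (j 7) i /
      alongX (grad φ.base (toBase j)) (j 5) (j 7) 1 := by
  rw [h.newX_eq_div hS hW hU hj, totalX_comp (h.differentiableAt_base hU hj)]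

theorem newT_comp_eq_div (i : Fin 4) : newT φ.base (comp φ.base i) j =
    (alongX (grad φ.base (toBase j)) (j 5) (j 7) 1 *
        alongT (grad φ.base (toBase j)) (j 4) (j 6) i -
      alongT (grad φ.base (toBase j)) (j 4) (j 6) 1 *
        alongX (grad φ.base (toBase j)) (j 5) (j 7) i) /
    (grad φ.base (toBase j) 0 0 * alongX (grad φ.base (toBase j)) (j 5) (j 7) 1) := by
  have hd := h.differentiableAt_base hU hj
  rw [newT, h.jac_eq_mul hS hW hU hj]
  simp only [totalT_comp hd, totalX_comp hd]

end Jets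

variable {z : Base} (hz : z ∈ U)

include h hS hW hU hz

theorem jac_jet_ne_zero {q s : ℝ} (hX : alongX (grad φ.base z) q s 1 ≠ 0) (p r w y : ℝ) :
    jac φ.base (jet z p q r s w y) ≠ 0 := by
  rw [h.jac_eq_mul hS hW hU (by rwa [toBase_jet]), toBase_jet]
  exact mul_ne_zero (h.grad_time_ne_zero hS hW hU hz) hX

theorem exists_alongX_one_ne_zero : ∃ q s : ℝ, alongX (grad φ.base z) q s 1 ≠ 0 := by
  obtain ⟨p, q, r, s, hne⟩ := exists_minorX_one_ne_zero (h.linearIndependent_row hU hz)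
  refine ⟨q, s, fun hX => hne ?_⟩
  rw [minorX, h.alongX_zero_eq_zero hS hW hU hz hne, hX, mul_zero, zero_mul, sub_zero]

/-- Here `h_t = -(u h_x + h u_x)`, and `u_xx` is chosen so as to satisfy the momentum equation. -/
theorem mass_eq_of_alongX_ne_zero (p : ℝ) {q s : ℝ} (hX : alongX (grad φ.base z) q s 1 ≠ 0) :
    alongX (grad φ.base z) q s 1 * alongT (grad φ.base z) p (-(z 2 * s + z 3 * q)) 3 -
      alongT (grad φ.base z) p (-(z 2 * s + z 3 * q)) 1 * alongX (grad φ.base z) q s 3 +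
      grad φ.base z 0 0 * (φ.base z 2 * alongX (grad φ.base z) q s 3 +
        φ.base z 3 * alongX (grad φ.base z) q s 2) = 0 := by
  obtain ⟨c, hc, hc0⟩ := hW
  have hτ := h.grad_time_ne_zero hS ⟨c, hc, hc0⟩ hU hz
  obtain ⟨f, hf⟩ := h.exists_arb_eq hS hc hc0
  have hjU : toBase (jet z p q (-(z 2 * s + z 3 * q)) s ((p + z 2 * q + s) / c) 0) ∈ U := by
    rwa [toBase_jet]
  have hmass := ((hf _ hjU (h.jac_jet_ne_zero hS ⟨c, hc, hc0⟩ hU hz hX _ _ _ _)).2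
    (by simp only [jet, Matrix.cons_val]; field_simp; ring)
    (by simp only [jet, Matrix.cons_val]; ring)).2
  simp only [prolong, Matrix.cons_val, comp, h.newT_comp_eq_div hS ⟨c, hc, hc0⟩ hU hjU,
    h.newX_comp_eq_div hS ⟨c, hc, hc0⟩ hU hjU] at hmass
  simp only [toBase_jet] at hmass
  simp only [jet, Matrix.cons_val] at hmass
  field_simp at hmass
  linear_combination hmass

theorem mass_eq (p q s : ℝ) :
    alongX (grad φ.base z) q s 1 * alongT (grad φ.base z) p (-(z 2 * s + z 3 * q)) 3 -
      alongT (grad φ.base z) p (-(z 2 * s + z 3 * q)) 1 * alongX (grad φ.base z) q s 3 +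
      grad φ.base z 0 0 * (φ.base z 2 * alongX (grad φ.base z) q s 3 +
        φ.base z 3 * alongX (grad φ.base z) q s 2) = 0 := by
  obtain ⟨q₀, s₀, hX₀⟩ := h.exists_alongX_one_ne_zero hS hW hU hz
  refine eq_zero_of_analytic (E := ℝ × ℝ) (v₀ := (q₀, s₀))
    (J := fun v => alongX (grad φ.base z) v.1 v.2 1)
    (f := fun v => alongX (grad φ.base z) v.1 v.2 1 *
        alongT (grad φ.base z) p (-(z 2 * v.2 + z 3 * v.1)) 3 -
      alongT (grad φ.base z) p (-(z 2 * v.2 + z 3 * v.1)) 1 * alongX (grad φ.base z) v.1 v.2 3 +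
      grad φ.base z 0 0 * (φ.base z 2 * alongX (grad φ.base z) v.1 v.2 3 +
        φ.base z 3 * alongX (grad φ.base z) v.1 v.2 2))
    (by unfold alongX alongT; fun_prop) (by unfold alongX; fun_prop) hX₀
    (fun v hv => h.mass_eq_of_alongX_ne_zero hS hW hU hz p hv) (q, s)

theorem grad_space_velocity_eq_zero_and_grad_height_velocity_eq_zero :
    grad φ.base z 1 2 = 0 ∧ grad φ.base z 3 2 = 0 := by
  have hmass := h.mass_eq hS hW hU hz
  have h00 := h.grad_time_ne_zero hS hW hU hz
  have h01 := h.grad_time_eq_zero hS hW hU hz (k := 1) (by decide)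
  have h02 := h.grad_time_eq_zero hS hW hU hz (k := 2) (by decide)
  have h03 := h.grad_time_eq_zero hS hW hU hz (k := 3) (by decide)
  have hrow := Fintype.linearIndependent_iff.1 (h.linearIndependent_row hU hz)
  set A := grad φ.base z
  simp only [alongX, alongT] at hmass
  have hp : A 1 1 * A 3 2 - A 1 2 * A 3 1 = 0 := by linear_combination hmass 1 0 0 - hmass 0 0 0
  have hps : A 1 3 * A 3 2 - A 1 2 * A 3 3 = 0 := by
    linear_combination hmass 1 0 1 - hmass 0 0 1 - hmass 1 0 0 + hmass 0 0 0
  have hdep := hrow ![-(A 3 2 * A 1 0 - A 1 2 * A 3 0) / A 0 0, A 3 2, 0, -A 1 2]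
    (funext fun k => by
      rw [Fin.sum_univ_four]
      fin_cases k
      · simp; field_simp; ring
      · simp [h01]; linear_combination hp
      · simp [h02]; ring
      · simp [h03]; linear_combination hps)
  exact ⟨neg_eq_zero.1 (hdep 3), hdep 1⟩

theorem grad_velocity_velocity_ne_zero : grad φ.base z 2 2 ≠ 0 := fun h22 => by
  obtain ⟨h12, h32⟩ := h.grad_space_velocity_eq_zero_and_grad_height_velocity_eq_zero hS hW hU hz
  refine (Matrix.linearIndependent_cols_iff_isUnit.2 (h.isUnit_grad_base hU hz)).ne_zero 2 ?_
  funext i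
  fin_cases i
  exacts [h.grad_time_eq_zero hS hW hU hz (by decide), h12, h22, h32]

end IsEquivalenceTransformation

/-! ### The momentum equation -/

theorem contDiffAt_pd {f : Base → ℝ} {z : Base} (hf : ContDiffAt ℝ ∞ f z) (k : Fin 4) :
    ContDiffAt ℝ ∞ (pd k f) z :=
  (hf.fderiv_right (m := ∞) (by simp)).clm_apply contDiffAt_const

theorem contDiffAt_grad {g : Base → Base} {z : Base} (hg : ContDiffAt ℝ ∞ g z) (i k : Fin 4) :
    ContDiffAt ℝ ∞ (fun z => grad g z i k) z :=
  contDiffAt_pd (contDiffAt_pi.1 hg i) k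

theorem exists_mem_notMem_of_isOpen {W : Set ℝ} (hW : IsOpen W) (hne : W.Nonempty) {s : Set ℝ}
    (hs : s.Finite) : ∃ c ∈ W, c ∉ s := by
  obtain ⟨c, hc, hcs⟩ := (hs.countable.dense_compl ℝ).inter_open_nonempty W hW hne
  exact ⟨c, hc, hcs⟩

theorem exists_mem_ne_zero {W : Set ℝ} (hW : IsOpen W) (hne : W.Nonempty) : ∃ c ∈ W, c ≠ 0 :=
  exists_mem_notMem_of_isOpen hW hne (Set.finite_singleton 0)

theorem exists_hasFDerivAt_alongX_grad {g : Base → Base} {j : Jet}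
    (hg : ContDiffAt ℝ ∞ g (toBase j)) (i : Fin 4) :
    ∃ L : Jet →L[ℝ] ℝ,
      HasFDerivAt (fun j => alongX (grad g (toBase j)) (j 5) (j 7) i) L j ∧
      ∀ v, L v = alongX (fun i k => fderiv ℝ (fun z => grad g z i k) (toBase j) (toBase v))
          (j 5) (j 7) i + v 5 * grad g (toBase j) i 2 + v 7 * grad g (toBase j) i 3 := by
  have hentry (k : Fin 4) : HasFDerivAt (fun j => grad g (toBase j) i k)
      ((fderiv ℝ (fun z => grad g z i k) (toBase j)).comp toBaseL) j := by
    simp only [← toBaseL_apply] at hg ⊢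
    exact ((contDiffAt_grad hg i k).differentiableAt (by simp)).hasFDerivAt.comp
      (f := toBaseL) j toBaseL.hasFDerivAt
  have hcoord (l : Fin 14) := (ContinuousLinearMap.proj (R := ℝ)
    (φ := fun _ : Fin 14 => ℝ) l).hasFDerivAt (x := j)
  refine ⟨_, ((hentry 1).add ((hcoord 5).mul (hentry 2))).add ((hcoord 7).mul (hentry 3)),
    fun v => ?_⟩
  simp only [ContinuousLinearMap.proj_apply, add_apply, ContinuousLinearMap.comp_apply,
    toBaseL_apply, smul_apply, smul_eq_mul, alongX]
  ring

namespace IsEquivalenceTransformation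

variable {S : Set ArbElem} {U : Set Base} {W : Set ℝ} {φ : Transf}
  (h : IsEquivalenceTransformation S U W φ)

variable (hU : IsOpen U)

include h hU

theorem contDiffAt_base {z : Base} (hz : z ∈ U) : ContDiffAt ℝ ∞ φ.base z :=
  h.smooth_base.contDiffAt (hU.mem_nhds hz)

theorem continuousAt_jac {j : Jet} (hj : toBase j ∈ U) : ContinuousAt (jac φ.base) j := by
  have hgrad : ContinuousAt (fun j => grad φ.base (toBase j)) j :=
    continuousAt_pi.2 fun i => continuousAt_pi.2 fun k => ContinuousAt.comp (f := toBase)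
      (contDiffAt_grad (h.contDiffAt_base hU hj) i k).continuousAt continuous_toBase.continuousAt
  have hminor : Continuous fun v : Matrix (Fin 4) (Fin 4) ℝ × Jet =>
      minorX v.1 (v.2 4) (v.2 5) (v.2 6) (v.2 7) 1 := by
    unfold minorX alongT alongX
    fun_prop
  refine (hminor.continuousAt.comp (f := fun j => (grad φ.base (toBase j), j))
    (hgrad.prodMk continuousAt_id)).congr ?_
  filter_upwards [continuous_toBase.continuousAt.eventually (hU.mem_nhds hj)] with j' hj'
  exact (jac_eq_minorX (h.differentiableAt_base hU hj')).symm

theorem isOpen_domain (hW : IsOpen W) : IsOpen (φ.domain U W) := by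
  refine isOpen_iff_mem_nhds.2 fun m hm => ?_
  filter_upwards [(isOpen_cylinder hU hW).mem_nhds hm.1, continuous_fst.continuousAt.eventually
    ((h.continuousAt_jac hU hm.1.1).eventually_ne hm.2)] with m' hmem hjac using ⟨hmem, hjac⟩

theorem exists_arb_ne_zero (hW : IsOpen W) (hne : W.Nonempty) {j : Jet} (hj : toBase j ∈ U)
    (hjac : jac φ.base j ≠ 0) : ∃ c ∈ W, c ≠ 0 ∧ φ.arb (j, c) ≠ 0 := by
  by_contra! hzero
  obtain ⟨c, hc, hc0⟩ := exists_mem_ne_zero hW hne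
  have hm : ((j, c) : ExtJet) ∈ φ.domain U W := ⟨⟨hj, hc⟩, hjac⟩
  have hline : HasDerivAt (fun t : ℝ => ((j, t) : ExtJet)) (0, 1) c :=
    (hasDerivAt_const c j).prodMk (hasDerivAt_id c)
  have harb := ((h.smooth_arb.contDiffAt ((h.isOpen_domain hU hW).mem_nhds hm)).differentiableAt
    (by simp)).hasFDerivAt.comp_hasDerivAt c hline
  have hconst : φ.arb ∘ (fun t : ℝ => ((j, t) : ExtJet)) =ᶠ[𝓝 c] fun _ => 0 := by
    filter_upwards [hW.mem_nhds hc, isOpen_ne.mem_nhds hc0] with t ht ht0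
      using hzero t ht ht0
  exact h.deriv_arb _ hm (harb.unique ((hasDerivAt_const c (0 : ℝ)).congr_of_eventuallyEq hconst))

end IsEquivalenceTransformation

theorem fderiv_div_apply {E : Type*} [NormedAddCommGroup E] [NormedSpace ℝ E] {a b : E → ℝ}
    {a' b' : E →L[ℝ] ℝ} {x : E} (ha : HasFDerivAt a a' x) (hb : HasFDerivAt b b' x)
    (hx : b x ≠ 0) (v : E) :
    fderiv ℝ (fun x => a x / b x) x v = (a' v * b x - a x * b' v) / b x ^ 2 := by
  have hdiv : HasFDerivAt (fun x => a x / b x)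
      (a x • (-(b x ^ 2)⁻¹ • b') + (b x)⁻¹ • a') x := by
    simpa only [div_eq_mul_inv, Function.comp_apply] using
      ha.fun_mul ((hasDerivAt_inv hx).comp_hasFDerivAt x hb)
  rw [hdiv.fderiv]
  simp only [add_apply, smul_apply, smul_eq_mul]
  field_simp
  ring

namespace IsEquivalenceTransformation

variable {S : Set ArbElem} {U : Set Base} {W : Set ℝ} {φ : Transf}
  (h : IsEquivalenceTransformation S U W φ) (hS : HasNonzeroConstants S) (hU : IsOpen U)
  (hW : ∃ c ∈ W, c ≠ 0)

include h hS hU hW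

theorem exists_prolong_jet_eq {z : Base} (hz : z ∈ U) {q s : ℝ}
    (hX : alongX (grad φ.base z) q s 1 ≠ 0) :
    ∃ R, ∀ p r w y, prolong φ.base (jet z p q r s w y) 10 =
      (R + (w * grad φ.base z 2 2 + y * grad φ.base z 2 3) * alongX (grad φ.base z) q s 1 -
        alongX (grad φ.base z) q s 2 * (w * grad φ.base z 1 2 + y * grad φ.base z 1 3)) /
      alongX (grad φ.base z) q s 1 ^ 3 := by
  let D : Matrix (Fin 4) (Fin 4) ℝ :=
    fun i k => fderiv ℝ (fun z => grad φ.base z i k) z ![0, 1, q, s]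
  refine ⟨alongX D q s 2 * alongX (grad φ.base z) q s 1 -
    alongX (grad φ.base z) q s 2 * alongX D q s 1, fun p r w y => ?_⟩
  set j := jet z p q r s w y with hj
  have hjz : toBase j = z := toBase_jet ..
  have hjU : toBase j ∈ U := by rwa [hjz]
  obtain ⟨L₁, hL₁, hL₁v⟩ := exists_hasFDerivAt_alongX_grad (h.contDiffAt_base hU hjU) 1
  obtain ⟨L₂, hL₂, hL₂v⟩ := exists_hasFDerivAt_alongX_grad (h.contDiffAt_base hU hjU) 2
  have hslope : newX φ.base (comp φ.base 2) =ᶠ[𝓝 j] fun j =>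
      alongX (grad φ.base (toBase j)) (j 5) (j 7) 2 /
        alongX (grad φ.base (toBase j)) (j 5) (j 7) 1 := by
    filter_upwards [continuous_toBase.continuousAt.eventually (hU.mem_nhds hjU)] with j' hj'
    exact h.newX_comp_eq_div hS hW hU hj' 2
  have hXj : alongX (grad φ.base (toBase j)) (j 5) (j 7) 1 ≠ 0 := by rwa [hjz]
  change newX φ.base (newX φ.base (comp φ.base 2)) j = _
  rw [h.newX_eq_div hS hW hU hjU, (totalX_congr hslope).eq_of_nhds, totalX,
    fderiv_div_apply hL₂ hL₁ hXj, hL₁v, hL₂v, hjz,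
    show toBase ![0, 1, j 5, j 7, j 9, j 10, j 12, j 13, 0, 0, 0, 0, 0, 0] =
      ![0, 1, q, s] from rfl]
  simp only [hj, jet, Matrix.cons_val]
  field_simp
  ring

theorem args_prolong_eq {j : Jet} (hj : toBase j ∈ U) : args (prolong φ.base j) =
    ![φ.base (toBase j) 3,
      alongX (grad φ.base (toBase j)) (j 5) (j 7) 2 /
        alongX (grad φ.base (toBase j)) (j 5) (j 7) 1,
      alongX (grad φ.base (toBase j)) (j 5) (j 7) 3 /
        alongX (grad φ.base (toBase j)) (j 5) (j 7) 1] := by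
  rw [args_prolong, h.newX_comp_eq_div hS hW hU hj, h.newX_comp_eq_div hS hW hU hj]

theorem exists_momentum_eq {z : Base} (hz : z ∈ U) {q s : ℝ}
    (hX : alongX (grad φ.base z) q s 1 ≠ 0) :
    ∃ R, ∀ c ∈ W, c ≠ 0 → ∃ F,
      (∀ j, toBase j = z → j 5 = q → j 7 = s → φ.arb (j, c) = F) ∧
      ∀ p w y, p + z 2 * q + s = c * w →
        alongX (grad φ.base z) q s 1 ^ 2 *
          (alongX (grad φ.base z) q s 1 *
              alongT (grad φ.base z) p (-(z 2 * s + z 3 * q)) 2 -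
            alongT (grad φ.base z) p (-(z 2 * s + z 3 * q)) 1 * alongX (grad φ.base z) q s 2 +
            grad φ.base z 0 0 *
              (φ.base z 2 * alongX (grad φ.base z) q s 2 + alongX (grad φ.base z) q s 3)) =
        grad φ.base z 0 0 * F *
          (R + (w * grad φ.base z 2 2 + y * grad φ.base z 2 3) * alongX (grad φ.base z) q s 1 -
            alongX (grad φ.base z) q s 2 * (w * grad φ.base z 1 2 + y * grad φ.base z 1 3)) := by
  obtain ⟨R, hR⟩ := h.exists_prolong_jet_eq hS hU hW hz hX
  refine ⟨R, fun c hc hc0 => ?_⟩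
  obtain ⟨f, hf⟩ := h.exists_arb_eq hS hc hc0
  have hτ := h.grad_time_ne_zero hS hW hU hz
  have hjac {j : Jet} (hj : toBase j = z) (h5 : j 5 = q) (h7 : j 7 = s) :
      jac φ.base j ≠ 0 := by
    subst hj h5 h7
    rw [h.jac_eq_mul hS hW hU hz]
    exact mul_ne_zero hτ hX
  refine ⟨f ![φ.base z 3, alongX (grad φ.base z) q s 2 / alongX (grad φ.base z) q s 1,
    alongX (grad φ.base z) q s 3 / alongX (grad φ.base z) q s 1], fun j hj h5 h7 => ?_,
    fun p w y hp => ?_⟩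
  · have hjU : toBase j ∈ U := by rwa [hj]
    rw [(hf j hjU (hjac hj h5 h7)).1, h.args_prolong_eq hS hU hW hjU, hj, h5, h7]
  · set j := jet z p q (-(z 2 * s + z 3 * q)) s w y with hj
    have hjz : toBase j = z := toBase_jet ..
    have hjU : toBase j ∈ U := by rwa [hjz]
    have hmom := ((hf j hjU (hjac hjz rfl rfl)).2
      (by simp only [hj, jet, Matrix.cons_val]; linear_combination hp)
      (by simp only [hj, jet, Matrix.cons_val]; ring)).1
    rw [h.args_prolong_eq hS hU hW hjU, hR, hjz] at hmom
    simp only [prolong, Matrix.cons_val, comp, h.newT_comp_eq_div hS hW hU hjU,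
      h.newX_comp_eq_div hS hW hU hjU, hjz] at hmom
    simp only [hj, jet, Matrix.cons_val] at hmom
    field_simp at hmom
    linear_combination hmom

end IsEquivalenceTransformation

namespace IsEquivalenceTransformation

variable {S : Set ArbElem} {U : Set Base} {W : Set ℝ} {φ : Transf}
  (h : IsEquivalenceTransformation S U W φ) (hS : HasNonzeroConstants S) (hU : IsOpen U)
  (hW : IsOpen W) (hne : W.Nonempty) {z : Base} (hz : z ∈ U)

include h hS hU hW hne hz

theorem grad_height_mul_alongX_of_ne_zero {q s : ℝ} (hX : alongX (grad φ.base z) q s 1 ≠ 0) :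
    grad φ.base z 2 3 * alongX (grad φ.base z) q s 1 -
      alongX (grad φ.base z) q s 2 * grad φ.base z 1 3 = 0 := by
  have hW0 : ∃ c ∈ W, c ≠ 0 := exists_mem_ne_zero hW hne
  obtain ⟨c, hc, hc0, harb⟩ := h.exists_arb_ne_zero hU hW hne (j := jet z 0 q 0 s 0 0)
    (by rwa [toBase_jet]) (h.jac_jet_ne_zero hS hW0 hU hz hX _ _ _ _)
  obtain ⟨R, hR⟩ := h.exists_momentum_eq hS hU hW0 hz hX
  obtain ⟨F, hF, hmom⟩ := hR c hc hc0
  rw [hF _ (toBase_jet ..) rfl rfl] at harb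
  have hp : (c - (z 2 * q + s)) + z 2 * q + s = c * 1 := by ring
  have hy := (hmom _ _ 1 hp).symm.trans (hmom _ _ 0 hp)
  rw [mul_right_inj' (mul_ne_zero (h.grad_time_ne_zero hS hW0 hU hz) harb)] at hy
  linear_combination hy

theorem grad_space_height_eq_zero_and_grad_velocity_height_eq_zero :
    grad φ.base z 1 3 = 0 ∧ grad φ.base z 2 3 = 0 := by
  have hW0 : ∃ c ∈ W, c ≠ 0 := exists_mem_ne_zero hW hne
  obtain ⟨q₀, s₀, hX₀⟩ := h.exists_alongX_one_ne_zero hS hW0 hU hz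
  have h12 := (h.grad_space_velocity_eq_zero_and_grad_height_velocity_eq_zero hS hW0 hU hz).1
  have h22 := h.grad_velocity_velocity_ne_zero hS hW0 hU hz
  have hpoly := eq_zero_of_analytic (E := ℝ × ℝ) (v₀ := (q₀, s₀))
    (f := fun v => grad φ.base z 2 3 * alongX (grad φ.base z) v.1 v.2 1 -
      alongX (grad φ.base z) v.1 v.2 2 * grad φ.base z 1 3)
    (J := fun v => alongX (grad φ.base z) v.1 v.2 1)
    (by unfold alongX; fun_prop) (by unfold alongX; fun_prop) hX₀
    fun v hv => h.grad_height_mul_alongX_of_ne_zero hS hU hW hne hz hv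
  have h00 := hpoly (0, 0)
  have h10 := hpoly (1, 0)
  simp only [alongX, h12] at h00 h10 hX₀
  have h13 : grad φ.base z 1 3 = 0 := (mul_eq_zero.1
    (by linear_combination h00 - h10 : grad φ.base z 2 2 * grad φ.base z 1 3 = 0)).resolve_left h22
  rw [h13] at h00 hX₀
  refine ⟨h13, (mul_eq_zero.1 (?_ : grad φ.base z 2 3 * grad φ.base z 1 1 = 0)).resolve_right ?_⟩
  · linear_combination h00
  · rwa [mul_zero, add_zero, mul_zero, add_zero] at hX₀

theorem alongX_one_eq (q s : ℝ) : alongX (grad φ.base z) q s 1 = grad φ.base z 1 1 := by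
  have hW0 : ∃ c ∈ W, c ≠ 0 := exists_mem_ne_zero hW hne
  rw [alongX, (h.grad_space_velocity_eq_zero_and_grad_height_velocity_eq_zero hS hW0 hU hz).1,
    (h.grad_space_height_eq_zero_and_grad_velocity_height_eq_zero hS hU hW hne hz).1,
    mul_zero, mul_zero, add_zero, add_zero]

theorem grad_space_space_ne_zero : grad φ.base z 1 1 ≠ 0 := by
  obtain ⟨q, s, hX⟩ := h.exists_alongX_one_ne_zero hS
    (exists_mem_ne_zero hW hne) hU hz
  rwa [h.alongX_one_eq hS hU hW hne hz] at hX

theorem exists_arb_eq_and_momentum_eq (q s : ℝ) : ∃ R, ∀ c ∈ W, c ≠ 0 →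
    (∀ j, toBase j = z → j 5 = q → j 7 = s →
      φ.arb (j, c) = c * grad φ.base z 1 1 ^ 2 / grad φ.base z 0 0) ∧
    grad φ.base z 1 1 * (grad φ.base z 2 0 - (z 2 * q + s) * grad φ.base z 2 2) -
      grad φ.base z 1 0 * (grad φ.base z 2 1 + q * grad φ.base z 2 2) +
      grad φ.base z 0 0 * (φ.base z 2 * (grad φ.base z 2 1 + q * grad φ.base z 2 2) +
        (grad φ.base z 3 1 + s * grad φ.base z 3 3)) = c * R := by
  have hW0 : ∃ c ∈ W, c ≠ 0 := exists_mem_ne_zero hW hne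
  have h00 := h.grad_time_ne_zero hS hW0 hU hz
  have h11 := h.grad_space_space_ne_zero hS hU hW hne hz
  have h22 := h.grad_velocity_velocity_ne_zero hS hW0 hU hz
  obtain ⟨h12, h32⟩ := h.grad_space_velocity_eq_zero_and_grad_height_velocity_eq_zero hS hW0 hU hz
  obtain ⟨h13, h23⟩ :=
    h.grad_space_height_eq_zero_and_grad_velocity_height_eq_zero hS hU hW hne hz
  have hX := h.alongX_one_eq hS hU hW hne hz q s
  obtain ⟨R, hR⟩ := h.exists_momentum_eq hS hU hW0 hz (hX ▸ h11)
  refine ⟨R, fun c hc hc0 => ?_⟩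
  obtain ⟨F, hF, hmom⟩ := hR c hc hc0
  have hmom₀ := hmom (-(z 2 * q + s)) 0 0 (by ring)
  have hmom₁ := hmom (c - (z 2 * q + s)) 1 0 (by ring)
  rw [hX] at hmom₀ hmom₁
  simp only [alongX, alongT, h12, h13, h23, h32] at hmom₀ hmom₁
  set A := grad φ.base z
  have hFA : F * A 0 0 = c * A 1 1 ^ 2 := mul_right_cancel₀ (mul_ne_zero h11 h22)
    (by linear_combination hmom₀ - hmom₁)
  refine ⟨fun j hj h5 h7 => (hF j hj h5 h7).trans ((eq_div_iff h00).2 hFA),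
    mul_left_cancel₀ (pow_ne_zero 2 h11) ?_⟩
  linear_combination hmom₀ + R * hFA

theorem arb_eq {j : Jet} (hj : toBase j = z) {c : ℝ} (hc : c ∈ W) (hc0 : c ≠ 0) :
    φ.arb (j, c) = c * grad φ.base z 1 1 ^ 2 / grad φ.base z 0 0 :=
  have ⟨_, hR⟩ := h.exists_arb_eq_and_momentum_eq hS hU hW hne hz (j 5) (j 7)
  (hR c hc hc0).1 j hj rfl rfl

theorem momentum_eq (q s : ℝ) :
    grad φ.base z 1 1 * (grad φ.base z 2 0 - (z 2 * q + s) * grad φ.base z 2 2) -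
      grad φ.base z 1 0 * (grad φ.base z 2 1 + q * grad φ.base z 2 2) +
      grad φ.base z 0 0 * (φ.base z 2 * (grad φ.base z 2 1 + q * grad φ.base z 2 2) +
        (grad φ.base z 3 1 + s * grad φ.base z 3 3)) = 0 := by
  obtain ⟨R, hR⟩ := h.exists_arb_eq_and_momentum_eq hS hU hW hne hz q s
  obtain ⟨c₁, hc₁, hc₁0⟩ := exists_mem_ne_zero hW hne
  obtain ⟨c₂, hc₂, hc₂'⟩ := exists_mem_notMem_of_isOpen hW hne (Set.toFinite {0, c₁})
  obtain ⟨hc₂0, hc₁₂⟩ : c₂ ≠ 0 ∧ c₂ ≠ c₁ := by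
    simpa only [Set.mem_insert_iff, Set.mem_singleton_iff, not_or] using hc₂'
  have hR0 : R = 0 := (mul_eq_zero.1 (sub_mul c₂ c₁ R ▸ sub_eq_zero.2
    ((hR c₂ hc₂ hc₂0).2.symm.trans (hR c₁ hc₁ hc₁0).2))).resolve_left (sub_ne_zero.2 hc₁₂)
  rw [(hR c₁ hc₁ hc₁0).2, hR0, mul_zero]

end IsEquivalenceTransformation

/-! ### The determining equations -/

/-- The first-order system for the projection `g` of an equivalence transformation to the space of
`(t, x, u, h)`: `t'` depends on `t` only, `x'` on `(t, x)` only, and the remaining equations are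
read off the coefficients of the derivatives in the transformed shallow-water system. -/
structure DeterminingEquations (g : Base → Base) (U : Set Base) : Prop where
  contDiffAt : ∀ z ∈ U, ContDiffAt ℝ ∞ g z
  time : ∀ z ∈ U, ∀ k, k ≠ 0 → grad g z 0 k = 0
  space_velocity : ∀ z ∈ U, grad g z 1 2 = 0
  space_height : ∀ z ∈ U, grad g z 1 3 = 0
  velocity_height : ∀ z ∈ U, grad g z 2 3 = 0
  time_ne_zero : ∀ z ∈ U, grad g z 0 0 ≠ 0
  space_ne_zero : ∀ z ∈ U, grad g z 1 1 ≠ 0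
  velocity_eq : ∀ z ∈ U, grad g z 0 0 * g z 2 = z 2 * grad g z 1 1 + grad g z 1 0
  height_eq : ∀ z ∈ U,
    grad g z 0 0 * (grad g z 0 0 * g z 3) = z 3 * (grad g z 1 1 * grad g z 1 1)
  momentum_eq : ∀ z ∈ U,
    grad g z 1 1 * (grad g z 2 0 + z 2 * grad g z 2 1) + grad g z 0 0 * grad g z 3 1 = 0
  mass_eq : ∀ z ∈ U,
    grad g z 1 1 * (grad g z 3 0 + z 2 * grad g z 3 1) + grad g z 0 0 * g z 3 * grad g z 2 1 = 0

theorem IsEquivalenceTransformation.determiningEquations {S : Set ArbElem} {U : Set Base}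
    {W : Set ℝ} {φ : Transf} (h : IsEquivalenceTransformation S U W φ)
    (hS : HasNonzeroConstants S) (hU : IsOpen U) (hW : IsOpen W) (hne : W.Nonempty) :
    DeterminingEquations φ.base U := by
  have hW0 : ∃ c ∈ W, c ≠ 0 := exists_mem_ne_zero hW hne
  have hcol := fun z (hz : z ∈ U) =>
    h.grad_space_velocity_eq_zero_and_grad_height_velocity_eq_zero hS hW0 hU hz
  have hrow := fun z (hz : z ∈ U) =>
    h.grad_space_height_eq_zero_and_grad_velocity_height_eq_zero hS hU hW hne hz
  have h22 := fun z (hz : z ∈ U) => h.grad_velocity_velocity_ne_zero hS hW0 hU hz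
  have hmomentum := fun z (hz : z ∈ U) => h.momentum_eq hS hU hW hne hz
  have hmass (z : Base) (hz : z ∈ U) (q s : ℝ) :
      grad φ.base z 1 1 * (grad φ.base z 3 0 - (z 2 * s + z 3 * q) * grad φ.base z 3 3) -
        grad φ.base z 1 0 * (grad φ.base z 3 1 + s * grad φ.base z 3 3) +
        grad φ.base z 0 0 * (φ.base z 2 * (grad φ.base z 3 1 + s * grad φ.base z 3 3) +
          φ.base z 3 * (grad φ.base z 2 1 + q * grad φ.base z 2 2)) = 0 := by
    have hE := h.mass_eq hS hW0 hU hz 0 q s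
    simp only [alongX, alongT, hcol z hz, hrow z hz] at hE
    linear_combination hE
  have hvelocity (z : Base) (hz : z ∈ U) :
      grad φ.base z 0 0 * φ.base z 2 = z 2 * grad φ.base z 1 1 + grad φ.base z 1 0 :=
    mul_left_cancel₀ (h22 z hz) (by linear_combination hmomentum z hz 1 0 - hmomentum z hz 0 0)
  exact
    { contDiffAt := fun z hz => h.contDiffAt_base hU hz
      time := fun z hz k hk => h.grad_time_eq_zero hS hW0 hU hz hk
      space_velocity := fun z hz => (hcol z hz).1
      space_height := fun z hz => (hrow z hz).1
      velocity_height := fun z hz => (hrow z hz).2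
      time_ne_zero := fun z hz => h.grad_time_ne_zero hS hW0 hU hz
      space_ne_zero := fun z hz => h.grad_space_space_ne_zero hS hU hW hne hz
      velocity_eq := hvelocity
      height_eq := fun z hz => mul_left_cancel₀ (h22 z hz) (by
        linear_combination grad φ.base z 0 0 * (hmass z hz 1 0 - hmass z hz 0 0) +
          grad φ.base z 1 1 * z 3 * (hmomentum z hz 0 1 - hmomentum z hz 0 0))
      momentum_eq := fun z hz => by
        linear_combination hmomentum z hz 0 0 - grad φ.base z 2 1 * hvelocity z hz
      mass_eq := fun z hz => by
        linear_combination hmass z hz 0 0 - grad φ.base z 3 1 * hvelocity z hz }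

/-- `f` is differentiable at `z`, with partial derivative `f'` in the `k`-th direction: the
analogue of `HasDerivAt` for `pd`. -/
def HasPD (k : Fin 4) (f : Base → ℝ) (f' : ℝ) (z : Base) : Prop :=
  DifferentiableAt ℝ f z ∧ pd k f z = f'

namespace HasPD

variable {k : Fin 4} {f g : Base → ℝ} {f' g' : ℝ} {z : Base}

theorem of_contDiffAt (hf : ContDiffAt ℝ ∞ f z) : HasPD k f (pd k f z) z :=
  ⟨hf.differentiableAt (by simp), rfl⟩

theorem add (hf : HasPD k f f' z) (hg : HasPD k g g' z) :
    HasPD k (fun z => f z + g z) (f' + g') z :=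
  ⟨hf.1.fun_add hg.1, by rw [pd, fderiv_fun_add hf.1 hg.1, ← hf.2, ← hg.2]; rfl⟩

theorem sub (hf : HasPD k f f' z) (hg : HasPD k g g' z) :
    HasPD k (fun z => f z - g z) (f' - g') z :=
  ⟨hf.1.fun_sub hg.1, by rw [pd, fderiv_fun_sub hf.1 hg.1, ← hf.2, ← hg.2]; rfl⟩

theorem mul (hf : HasPD k f f' z) (hg : HasPD k g g' z) :
    HasPD k (fun z => f z * g z) (f z * g' + g z * f') z :=
  ⟨hf.1.fun_mul hg.1, by rw [pd, fderiv_fun_mul hf.1 hg.1, ← hf.2, ← hg.2]; rfl⟩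

theorem const (k : Fin 4) (c : ℝ) (z : Base) : HasPD k (fun _ => c) 0 z :=
  ⟨differentiableAt_const c, by rw [pd, fderiv_const_apply, zero_apply]⟩

theorem coord (k i : Fin 4) (z : Base) :
    HasPD k (fun z => z i) ((Pi.single k 1 : Base) i) z :=
  ⟨differentiableAt_apply i z, by
    rw [pd, (hasFDerivAt_apply (𝕜 := ℝ) (F' := fun _ : Fin 4 => ℝ) i z).fderiv]; rfl⟩

theorem unique_of_eqOn {U : Set Base} (hf : HasPD k f f' z) (hg : HasPD k g g' z) (hU : IsOpen U)
    (hz : z ∈ U) (h : Set.EqOn f g U) : f' = g' := by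
  rw [← hf.2, ← hg.2, pd, pd, (h.eventuallyEq_of_mem (hU.mem_nhds hz)).fderiv_eq]

end HasPD

theorem pd_comm {f : Base → ℝ} {z : Base} (hf : ContDiffAt ℝ ∞ f z) (k l : Fin 4) :
    pd k (pd l f) z = pd l (pd k f) z := by
  have hd : DifferentiableAt ℝ (fderiv ℝ f) z :=
    (hf.fderiv_right (m := ∞) (by simp)).differentiableAt (by simp)
  have hpd (k l : Fin 4) : pd k (pd l f) z =
      fderiv ℝ (fderiv ℝ f) z (Pi.single k 1) (Pi.single l 1) := by
    change fderiv ℝ (fun z => fderiv ℝ f z (Pi.single l 1)) z _ = _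
    rw [fderiv_clm_apply hd (differentiableAt_const _)]
    simp
  rw [hpd, hpd]
  exact ((contDiffAt_infty.1 hf 2).isSymmSndFDerivAt (by simp)).eq _ _

theorem pd_pd_eq_zero {U : Set Base} (hU : IsOpen U) {f : Base → ℝ} {k : Fin 4}
    (hf : ∀ z ∈ U, ContDiffAt ℝ ∞ f z) (h0 : ∀ z ∈ U, pd k f z = 0) (l : Fin 4) :
    ∀ z ∈ U, pd k (pd l f) z = 0 := fun z hz =>
  (pd_comm (hf z hz) k l).trans <|
    (HasPD.of_contDiffAt (contDiffAt_pd (hf z hz) k)).unique_of_eqOn (HasPD.const l 0 z) hU hz h0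

theorem exists_eqOn_const_of_hasPD_zero {U : Set Base} (hU : IsOpen U) (hUc : IsConnected U)
    {f : Base → ℝ} (hf : ∀ z ∈ U, ∀ k, HasPD k f 0 z) : ∃ c, ∀ z ∈ U, f z = c := by
  obtain ⟨z₀, hz₀⟩ := hUc.nonempty
  refine ⟨f z₀, fun z hz => hU.is_const_of_fderiv_eq_zero hUc.isPreconnected
    (fun z hz => (hf z hz 0).1.differentiableWithinAt) (fun z hz => ?_) hz hz₀⟩
  ext v
  simp only [fderiv_eq_sum_pd, (hf z hz _).2, mul_zero, Finset.sum_const_zero, Pi.zero_apply,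
    zero_apply]

namespace DeterminingEquations

variable {g : Base → Base} {U : Set Base} (hg : DeterminingEquations g U) (hU : IsOpen U)
  {z : Base}

include hg

theorem contDiffAt_apply (i : Fin 4) : ∀ z ∈ U, ContDiffAt ℝ ∞ (fun z => g z i) z :=
  fun z hz => contDiffAt_pi.1 (hg.contDiffAt z hz) i

theorem hasPD_apply (k i : Fin 4) (hz : z ∈ U) : HasPD k (fun z => g z i) (grad g z i k) z :=
  .of_contDiffAt (hg.contDiffAt_apply i z hz)

theorem hasPD_grad (k i l : Fin 4) (hz : z ∈ U) :
    HasPD k (grad g · i l) (pd k (grad g · i l) z) z :=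
  .of_contDiffAt (contDiffAt_grad (hg.contDiffAt z hz) i l)

theorem hasPD_pd_grad (m k i l : Fin 4) (hz : z ∈ U) :
    HasPD m (pd k (grad g · i l)) (pd m (pd k (grad g · i l)) z) z :=
  .of_contDiffAt (contDiffAt_pd (contDiffAt_grad (hg.contDiffAt z hz) i l) k)

theorem pd_grad_comm (k i l : Fin 4) (hz : z ∈ U) :
    pd k (grad g · i l) z = pd l (grad g · i k) z :=
  pd_comm (hg.contDiffAt_apply i z hz) k l

include hU

theorem pd_grad_time {k : Fin 4} (hk : k ≠ 0) : ∀ z ∈ U, pd k (grad g · 0 0) z = 0 :=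
  pd_pd_eq_zero hU (hg.contDiffAt_apply 0) (fun z hz => hg.time z hz k hk) 0

theorem pd_grad_space {k : Fin 4} (hk : k = 2 ∨ k = 3) (l : Fin 4) :
    ∀ z ∈ U, pd k (grad g · 1 l) z = 0 := by
  refine pd_pd_eq_zero hU (hg.contDiffAt_apply 1) ?_ l
  rcases hk with rfl | rfl
  exacts [hg.space_velocity, hg.space_height]

theorem pd_pd_grad_time {k : Fin 4} (hk : k ≠ 0) (l : Fin 4) (hz : z ∈ U) :
    pd k (pd l (grad g · 0 0)) z = 0 :=
  pd_pd_eq_zero hU (fun z hz => contDiffAt_grad (hg.contDiffAt z hz) 0 0)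
    (hg.pd_grad_time hU hk) l z hz

theorem pd_pd_grad_space {k : Fin 4} (hk : k = 2 ∨ k = 3) (l m : Fin 4) (hz : z ∈ U) :
    pd k (pd l (grad g · 1 m)) z = 0 :=
  pd_pd_eq_zero hU (fun z hz => contDiffAt_grad (hg.contDiffAt z hz) 1 m)
    (hg.pd_grad_space hU hk m) l z hz

theorem pd_velocity_eq (k : Fin 4) (hz : z ∈ U) :
    grad g z 0 0 * grad g z 2 k + g z 2 * pd k (grad g · 0 0) z =
      z 2 * pd k (grad g · 1 1) z + grad g z 1 1 * (Pi.single k 1 : Base) 2 +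
        pd k (grad g · 1 0) z :=
  ((hg.hasPD_grad k 0 0 hz).mul (hg.hasPD_apply k 2 hz)).unique_of_eqOn
    (((HasPD.coord k 2 z).mul (hg.hasPD_grad k 1 1 hz)).add (hg.hasPD_grad k 1 0 hz)) hU hz
    hg.velocity_eq

theorem pd_height_eq (k : Fin 4) (hz : z ∈ U) :
    grad g z 0 0 * (grad g z 0 0 * grad g z 3 k + g z 3 * pd k (grad g · 0 0) z) +
        grad g z 0 0 * g z 3 * pd k (grad g · 0 0) z =
      z 3 * (grad g z 1 1 * pd k (grad g · 1 1) z + grad g z 1 1 * pd k (grad g · 1 1) z) +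
        grad g z 1 1 * grad g z 1 1 * (Pi.single k 1 : Base) 3 :=
  ((hg.hasPD_grad k 0 0 hz).mul
    ((hg.hasPD_grad k 0 0 hz).mul (hg.hasPD_apply k 3 hz))).unique_of_eqOn
    ((HasPD.coord k 3 z).mul ((hg.hasPD_grad k 1 1 hz).mul (hg.hasPD_grad k 1 1 hz))) hU hz
    hg.height_eq

theorem grad_velocity_space (hz : z ∈ U) :
    grad g z 0 0 * grad g z 2 1 =
      z 2 * pd 1 (grad g · 1 1) z + pd 0 (grad g · 1 1) z := by
  have h1 := hg.pd_velocity_eq hU 1 hz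
  rw [hg.pd_grad_time hU one_ne_zero z hz, hg.pd_grad_comm 1 1 0 hz] at h1
  simpa using h1

theorem grad_height_space (hz : z ∈ U) :
    grad g z 0 0 * (grad g z 0 0 * grad g z 3 1) =
      2 * z 3 * grad g z 1 1 * pd 1 (grad g · 1 1) z := by
  have h1 := hg.pd_height_eq hU 1 hz
  rw [hg.pd_grad_time hU one_ne_zero z hz, Pi.single_eq_of_ne (by decide)] at h1
  linear_combination h1

/-- Up to the term with `u'` this is polynomial in `u` and `h`, so that differentiating in `u` and
`h` splits it. -/
theorem momentum_compatibility (hz : z ∈ U) :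
    z 2 * (2 * pd 0 (grad g · 1 1) z) + pd 0 (grad g · 1 0) z - pd 0 (grad g · 0 0) z * g z 2 +
      (z 2 * z 2 + 2 * z 3) * pd 1 (grad g · 1 1) z = 0 := by
  have h0 := hg.pd_velocity_eq hU 0 hz
  rw [Pi.single_eq_of_ne (by decide)] at h0
  refine mul_left_cancel₀ (hg.space_ne_zero z hz) ?_
  linear_combination grad g z 0 0 * hg.momentum_eq z hz - grad g z 1 1 * h0 -
    grad g z 1 1 * z 2 * hg.grad_velocity_space hU hz - hg.grad_height_space hU hz

theorem pd_momentum_compatibility {k : Fin 4} (hk : k = 2 ∨ k = 3) (hz : z ∈ U) :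
    2 * pd 0 (grad g · 1 1) z * (Pi.single k 1 : Base) 2 -
      pd 0 (grad g · 0 0) z * grad g z 2 k +
      pd 1 (grad g · 1 1) z *
        (2 * z 2 * (Pi.single k 1 : Base) 2 + 2 * (Pi.single k 1 : Base) 3) = 0 := by
  have hk0 : k ≠ 0 := by rintro rfl; revert hk; decide
  have hu := HasPD.coord k 2 z
  have ha := hg.hasPD_pd_grad k 0 1 1 hz
  have hd := (((hu.mul ((HasPD.const k 2 z).mul ha)).add (hg.hasPD_pd_grad k 0 1 0 hz)).sub
    ((hg.hasPD_pd_grad k 0 0 0 hz).mul (hg.hasPD_apply k 2 hz))).add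
    (((hu.mul hu).add ((HasPD.const k 2 z).mul (HasPD.coord k 3 z))).mul
      (hg.hasPD_pd_grad k 1 1 1 hz))
  have h0 := hd.unique_of_eqOn (HasPD.const k 0 z) hU hz
    fun z hz => hg.momentum_compatibility hU hz
  rw [hg.pd_pd_grad_space hU hk, hg.pd_pd_grad_space hU hk, hg.pd_pd_grad_space hU hk,
    hg.pd_pd_grad_time hU hk0] at h0
  · linear_combination h0
  all_goals exact hz

theorem pd_space_grad_space (hz : z ∈ U) : pd 1 (grad g · 1 1) z = 0 := by
  have h3 := hg.pd_momentum_compatibility hU (Or.inr rfl) hz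
  rw [hg.velocity_height z hz, Pi.single_eq_same, Pi.single_eq_of_ne (by decide)] at h3
  linear_combination h3 / 2

theorem two_mul_grad_time_mul (hz : z ∈ U) :
    2 * grad g z 0 0 * pd 0 (grad g · 1 1) z = pd 0 (grad g · 0 0) z * grad g z 1 1 := by
  have h2 := hg.pd_momentum_compatibility hU (Or.inl rfl) hz
  have hv := hg.pd_velocity_eq hU 2 hz
  rw [hg.pd_grad_time hU (by decide) z hz, hg.pd_grad_space hU (Or.inl rfl) 1 z hz,
    hg.pd_grad_space hU (Or.inl rfl) 0 z hz, Pi.single_eq_same] at hv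
  rw [hg.pd_space_grad_space hU hz, Pi.single_eq_same] at h2
  linear_combination grad g z 0 0 * h2 + pd 0 (grad g · 0 0) z * hv

theorem height_mul_pd_time_grad_space (hz : z ∈ U) : z 3 * pd 0 (grad g · 1 1) z = 0 := by
  have ha0 := hg.space_ne_zero z hz
  have hτ0 := hg.time_ne_zero z hz
  have hh0 := hg.pd_height_eq hU 0 hz
  have hux := hg.grad_velocity_space hU hz
  have hhx := hg.grad_height_space hU hz
  have hmass := hg.mass_eq z hz
  rw [hg.pd_space_grad_space hU hz, mul_zero] at hux hhx
  have hhx0 : grad g z 3 1 = 0 := by simpa [hτ0] using hhx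
  rw [hhx0] at hmass
  rw [Pi.single_eq_of_ne (by decide)] at hh0
  refine mul_left_cancel₀ (mul_ne_zero (pow_ne_zero 2 ha0) hτ0) ?_
  linear_combination grad g z 1 1 * grad g z 0 0 * hh0 - grad g z 0 0 ^ 3 * hmass +
    grad g z 0 0 ^ 3 * g z 3 * hux +
    (grad g z 0 0 * pd 0 (grad g · 1 1) z -
      2 * grad g z 1 1 * pd 0 (grad g · 0 0) z) * hg.height_eq z hz +
    2 * grad g z 1 1 ^ 2 * z 3 * hg.two_mul_grad_time_mul hU hz

theorem pd_time_grad_space (hz : z ∈ U) : pd 0 (grad g · 1 1) z = 0 := by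
  have h3 := ((HasPD.coord 3 3 z).mul (hg.hasPD_pd_grad 3 0 1 1 hz)).unique_of_eqOn
    (HasPD.const 3 0 z) hU hz fun z hz => hg.height_mul_pd_time_grad_space hU hz
  rwa [hg.pd_pd_grad_space hU (Or.inr rfl) 0 1 hz, Pi.single_eq_same, mul_zero, zero_add,
    mul_one] at h3

theorem pd_time_grad_time (hz : z ∈ U) : pd 0 (grad g · 0 0) z = 0 := by
  have h0 := hg.two_mul_grad_time_mul hU hz
  rw [hg.pd_time_grad_space hU hz, mul_zero, eq_comm] at h0
  exact (mul_eq_zero.1 h0).resolve_right (hg.space_ne_zero z hz)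

theorem pd_time_grad_space_time (hz : z ∈ U) : pd 0 (grad g · 1 0) z = 0 := by
  have h0 := hg.momentum_compatibility hU hz
  rw [hg.pd_time_grad_space hU hz, hg.pd_time_grad_time hU hz, hg.pd_space_grad_space hU hz] at h0
  linear_combination h0

theorem hasPD_grad_time_time (hz : z ∈ U) (k : Fin 4) : HasPD k (grad g · 0 0) 0 z := by
  convert hg.hasPD_grad k 0 0 hz using 1
  by_cases hk : k = 0
  exacts [hk ▸ (hg.pd_time_grad_time hU hz).symm, (hg.pd_grad_time hU hk z hz).symm]

theorem hasPD_grad_space_space (hz : z ∈ U) (k : Fin 4) : HasPD k (grad g · 1 1) 0 z := by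
  convert hg.hasPD_grad k 1 1 hz using 1
  symm
  fin_cases k
  exacts [hg.pd_time_grad_space hU hz, hg.pd_space_grad_space hU hz,
    hg.pd_grad_space hU (Or.inl rfl) 1 z hz, hg.pd_grad_space hU (Or.inr rfl) 1 z hz]

theorem hasPD_grad_space_time (hz : z ∈ U) (k : Fin 4) : HasPD k (grad g · 1 0) 0 z := by
  convert hg.hasPD_grad k 1 0 hz using 1
  symm
  fin_cases k
  exacts [hg.pd_time_grad_space_time hU hz,
    (hg.pd_grad_comm 1 1 0 hz).trans (hg.pd_time_grad_space hU hz),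
    hg.pd_grad_space hU (Or.inl rfl) 0 z hz, hg.pd_grad_space hU (Or.inr rfl) 0 z hz]

theorem exists_time_eq (hUc : IsConnected U) {τ : ℝ} (hτ : ∀ z ∈ U, grad g z 0 0 = τ) :
    ∃ t₀, ∀ z ∈ U, g z 0 = τ * z 0 + t₀ := by
  obtain ⟨t₀, ht₀⟩ := exists_eqOn_const_of_hasPD_zero hU hUc (f := fun z => g z 0 - τ * z 0)
    fun z hz k => by
      convert (hg.hasPD_apply k 0 hz).sub ((HasPD.const k τ z).mul (HasPD.coord k 0 z)) using 1
      by_cases hk : k = 0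
      · subst hk
        rw [hτ z hz, Pi.single_eq_same]
        ring
      · rw [hg.time z hz k hk, Pi.single_eq_of_ne' hk]
        ring
  exact ⟨t₀, fun z hz => sub_eq_iff_eq_add'.1 (ht₀ z hz)⟩

theorem exists_space_eq (hUc : IsConnected U) {a κ : ℝ} (ha : ∀ z ∈ U, grad g z 1 1 = a)
    (hκ : ∀ z ∈ U, grad g z 1 0 = κ) : ∃ x₀, ∀ z ∈ U, g z 1 = a * z 1 + κ * z 0 + x₀ := by
  obtain ⟨x₀, hx₀⟩ := exists_eqOn_const_of_hasPD_zero hU hUc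
    (f := fun z => g z 1 - (a * z 1 + κ * z 0)) fun z hz k => by
      convert (hg.hasPD_apply k 1 hz).sub (((HasPD.const k a z).mul (HasPD.coord k 1 z)).add
        ((HasPD.const k κ z).mul (HasPD.coord k 0 z))) using 1
      fin_cases k <;>
        simp [ha z hz, hκ z hz, hg.space_velocity z hz, hg.space_height z hz]
  exact ⟨x₀, fun z hz => sub_eq_iff_eq_add'.1 (hx₀ z hz)⟩

theorem exists_eqOn_base (hUc : IsConnected U) : ∃ f : Similarity, Set.EqOn g f.base U := by
  obtain ⟨τ, hτ⟩ := exists_eqOn_const_of_hasPD_zero hU hUc fun z => hg.hasPD_grad_time_time hU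
  obtain ⟨a, ha⟩ := exists_eqOn_const_of_hasPD_zero hU hUc fun z => hg.hasPD_grad_space_space hU
  obtain ⟨κ, hκ⟩ := exists_eqOn_const_of_hasPD_zero hU hUc fun z => hg.hasPD_grad_space_time hU
  obtain ⟨t₀, ht⟩ := hg.exists_time_eq hU hUc hτ
  obtain ⟨x₀, hx⟩ := hg.exists_space_eq hU hUc ha hκ
  obtain ⟨z₀, hz₀⟩ := hUc.nonempty
  have hτ0 : τ ≠ 0 := hτ z₀ hz₀ ▸ hg.time_ne_zero z₀ hz₀
  have ha0 : a ≠ 0 := ha z₀ hz₀ ▸ hg.space_ne_zero z₀ hz₀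
  refine ⟨⟨Units.mk0 τ hτ0, Units.mk0 (a / τ) (div_ne_zero ha0 hτ0), κ / τ, t₀, x₀⟩,
    fun z hz => ?_⟩
  have hu := hg.velocity_eq z hz
  have hh := hg.height_eq z hz
  rw [hτ z hz, ha z hz, hκ z hz] at hu
  rw [hτ z hz, ha z hz] at hh
  refine base_ext (ht z hz) ((hx z hz).trans ?_) ?_ ?_
  · change a * z 1 + κ * z 0 + x₀ = τ * (a / τ) * z 1 + τ * (κ / τ) * z 0 + x₀
    field_simp
  · change g z 2 = a / τ * z 2 + κ / τ
    field_simp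
    linear_combination hu
  · change g z 3 = (a / τ) ^ 2 * z 3
    field_simp
    linear_combination hh

end DeterminingEquations

theorem grad_congr {g g' : Base → Base} {z : Base} (h : g =ᶠ[𝓝 z] g') : grad g z = grad g' z := by
  ext i k
  have hi : (fun z => g z i) =ᶠ[𝓝 z] fun z => g' z i := h.fun_comp (· i)
  rw [grad_apply, grad_apply, pd, pd, hi.fderiv_eq]

theorem Similarity.grad_base_time_time (f : Similarity) (z : Base) : grad f.base z 0 0 = f.τ :=
  (((HasPD.const 0 (f.τ : ℝ) z).mul (HasPD.coord 0 0 z)).add (HasPD.const 0 f.t₀ z)).2.trans <| by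
    rw [Pi.single_eq_same]
    ring

theorem Similarity.grad_base_space_space (f : Similarity) (z : Base) :
    grad f.base z 1 1 = f.τ * f.b :=
  ((((HasPD.const 1 (f.τ * f.b : ℝ) z).mul (HasPD.coord 1 1 z)).add
    ((HasPD.const 1 (f.τ * f.k : ℝ) z).mul (HasPD.coord 1 0 z))).add
      (HasPD.const 1 f.x₀ z)).2.trans <| by
    rw [Pi.single_eq_same, Pi.single_eq_of_ne (by decide)]
    ring

theorem eq_of_eqOn_compl_singleton {f g : ℝ → ℝ} {W : Set ℝ} {a : ℝ} (hW : IsOpen W) (ha : a ∈ W)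
    (hf : ContinuousAt f a) (hg : ContinuousAt g a) (h : ∀ c ∈ W, c ≠ a → f c = g c) :
    f a = g a := by
  have hlim : Tendsto f (𝓝[≠] a) (𝓝 (f a)) := hf.mono_left nhdsWithin_le_nhds
  refine tendsto_nhds_unique hlim ((hg.mono_left nhdsWithin_le_nhds).congr' ?_)
  filter_upwards [nhdsWithin_le_nhds (hW.mem_nhds ha), self_mem_nhdsWithin] with c hc hca
  exact (h c hc hca).symm

theorem IsEquivalenceTransformation.exists_actsAs {S : Set ArbElem} {U : Set Base} {W : Set ℝ}
    {φ : Transf} (h : IsEquivalenceTransformation S U W φ) (hS : HasNonzeroConstants S)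
    (hU : IsOpen U) (hUc : IsConnected U) (hW : IsOpen W) (hne : W.Nonempty) :
    ∃ f, ActsAs φ f U W := by
  obtain ⟨f, hf⟩ := (h.determiningEquations hS hU hW hne).exists_eqOn_base hU hUc
  have harb (j : Jet) (hj : toBase j ∈ U) (c : ℝ) (hc : c ∈ W) (hc0 : c ≠ 0) :
      φ.arb (j, c) = f.τ * f.b ^ 2 * c := by
    rw [h.arb_eq hS hU hW hne hj rfl hc hc0, grad_congr (hf.eventuallyEq_of_mem (hU.mem_nhds hj)),
      f.grad_base_time_time, f.grad_base_space_space]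
    field_simp
  refine ⟨f, hf, ?_⟩
  rintro ⟨j, c⟩ hm
  rcases ne_or_eq c 0 with hc0 | rfl
  · exact harb j hm.1.1 c hm.1.2 hc0
  · have hcont : ContinuousAt (fun c : ℝ => φ.arb (j, c)) 0 :=
      ContinuousAt.comp (f := fun c : ℝ => ((j, c) : ExtJet))
        (h.smooth_arb.contDiffAt ((h.isOpen_domain hU hW).mem_nhds hm)).continuousAt
        (by fun_prop)
    exact eq_of_eqOn_compl_singleton hW hm.1.2 hcont (by fun_prop) (harb j hm.1.1)

/-! ### The equivalence algebra -/

theorem Similarity.actJet_one (j : Jet) : actJet 1 j = j := by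
  funext i
  fin_cases i <;> simp [actJet, one_def]

theorem differentiableAt_of_affine {a b : ℝ → ℝ} {s p δ : ℝ} (hδ : δ ≠ 0)
    (h : DifferentiableAt ℝ (fun r => a r * p + b r) s)
    (h' : DifferentiableAt ℝ (fun r => a r * (p + δ) + b r) s) :
    DifferentiableAt ℝ a s ∧ DifferentiableAt ℝ b s := by
  have ha : DifferentiableAt ℝ a s := ((h'.sub h).div_const δ).congr_of_eventuallyEq <|
    .of_forall fun r => by simp only [Pi.sub_apply]; field_simp; ring
  exact ⟨ha, (h.sub (ha.mul_const p)).congr_of_eventuallyEq <|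
    .of_forall fun r => by simp only [Pi.sub_apply]; ring⟩

theorem Similarity.exists_hasDerivAt_act {f : ℝ → Similarity} {s : ℝ} (hf : f s = 1)
    {V : Set Base} (hV : IsOpen V) (hne : V.Nonempty)
    (hd : ∀ z ∈ V, DifferentiableAt ℝ (fun r => (f r).base z) s) :
    ∃ c, ∀ y, HasDerivAt (fun r => (f r).act y) (field c y) s := by
  obtain ⟨z, hz⟩ := hne
  obtain ⟨δ, hδ, hz'⟩ := exists_add_const_mem hV hz
  have e := differentiableAt_pi.1 (hd z hz)
  have e' := differentiableAt_pi.1 (hd _ hz')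
  obtain ⟨hτ, ht₀⟩ : DifferentiableAt ℝ (fun r => ((f r).τ : ℝ)) s ∧
      DifferentiableAt ℝ (fun r => (f r).t₀) s := differentiableAt_of_affine hδ (e 0) (e' 0)
  obtain ⟨hb, hk⟩ : DifferentiableAt ℝ (fun r => ((f r).b : ℝ)) s ∧
      DifferentiableAt ℝ (fun r => (f r).k) s := differentiableAt_of_affine hδ (e 2) (e' 2)
  have hx₀ : DifferentiableAt ℝ (fun r => (f r).x₀) s :=
    ((e 1).sub (((hτ.mul hb).mul_const (z 1)).add ((hτ.mul hk).mul_const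
      (z 0)))).congr_of_eventuallyEq <| .of_forall fun r => (add_sub_cancel_left _ _).symm
  refine ⟨![deriv (fun r => (f r).t₀) s, deriv (fun r => (f r).x₀) s, deriv (fun r => (f r).k) s,
    deriv (fun r => ((f r).τ : ℝ)) s,
    deriv (fun r => ((f r).τ : ℝ)) s + deriv (fun r => ((f r).b : ℝ)) s], fun y => ?_⟩
  refine (hasDerivAt_act hτ.hasDerivAt hb.hasDerivAt hk.hasDerivAt ht₀.hasDerivAt
    hx₀.hasDerivAt y).congr_deriv ?_
  rw [hf]
  apply total_ext <;> simp [field, one_def, -mul_eq_mul_right_iff] <;> ring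

theorem eq_of_eventuallyEq_field {z : Base} {c c' : Fin 5 → ℝ}
    (h : ∀ᶠ z' in 𝓝 z, (field c (z', 0)).1 = (field c' (z', 0)).1) : c = c' := by
  obtain ⟨V, hV, hVo, hz⟩ := eventually_nhds_iff.1 h
  exact eq_of_eqOn_field hVo ⟨z, hz⟩ hV

theorem exists_eventuallyEq_field_of_isConnected {U : Set Base} (hU : IsConnected U)
    {Q₀ : Base → Base} (h : ∀ z ∈ U, ∃ v, ∀ᶠ z' in 𝓝 z, Q₀ z' = (field v (z', 0)).1) :
    ∃ v, ∀ z ∈ U, ∀ᶠ z' in 𝓝 z, Q₀ z' = (field v (z', 0)).1 := by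
  choose! v hv using h
  obtain ⟨z₀, hz₀⟩ := hU.nonempty
  refine ⟨v z₀, fun z hz => ?_⟩
  have hconst : v z = v z₀ :=
    hU.isPreconnected.induction₂ (fun z z' => v z = v z') (fun z hz => ?_)
      (fun _ _ _ _ _ _ => Eq.trans) (fun _ _ _ _ => Eq.symm) hz hz₀
  · exact hconst ▸ hv z hz
  · filter_upwards [nhdsWithin_le_nhds (eventually_eventually_nhds.2 (hv z hz)),
      self_mem_nhdsWithin] with z' hz' hz'U
    refine eq_of_eventuallyEq_field (z := z') ?_
    filter_upwards [hz', hv z' hz'U] with z'' h1 h2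
    rw [← h1, h2]

namespace IsInfinitesimalEquivalence

variable {S : Set ArbElem} {U : Set Base} {W : Set ℝ} {Q : ExtJet → Total}
  (h : IsInfinitesimalEquivalence S U W Q) (hS : HasNonzeroConstants S)

include h hS

theorem exists_eq_field_locally {z : Base} (hz : z ∈ U) {c : ℝ} (hc : c ∈ W) :
    ∃ U₁ ∈ 𝓝 z, ∃ W₁ ∈ 𝓝 c, ∃ v, ∀ m ∈ cylinder U₁ W₁, Q m = field v (toTotal m) := by
  obtain ⟨U₁, -, W₁, -, ε, hε, φ, hU₁, hU₁c, hzU₁, hW₁, hcW₁, heq, -, -, hbase, harb, hder⟩ :=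
    h.generates z hz c hc
  have hact (s : ℝ) (hs : |s| < ε) : ∃ f, ActsAs (φ s) f U₁ W₁ :=
    (heq s hs).exists_actsAs hS hU₁ hU₁c hW₁ ⟨c, hcW₁⟩
  choose! f hf using hact
  have h0 : |(0 : ℝ)| < ε := by rwa [abs_zero]
  have hf0 : f 0 = 1 := eq_of_eqOn_base hU₁ ⟨z, hzU₁⟩ fun z' hz' => by
    rw [← (hf 0 h0).base_eqOn hz', hbase z' hz', base_one]
  have hQ (m : ExtJet) (hm : m ∈ cylinder U₁ W₁) :
      HasDerivAt (fun r => (f r).act (toTotal m)) (Q m) 0 := by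
    have hdom : m ∈ (φ 0).domain U₁ W₁ := by rwa [(hf 0 h0).domain_eq hU₁]
    have hφm : (φ 0).act m = m := by
      rw [(hf 0 h0).act_eq hU₁ hdom, ← (hf 0 h0).arb_eq m hdom, harb m hm, hf0, actJet_one]
    have hd := (hder 0 h0 m hdom).2
    rw [hφm] at hd
    refine hd.congr_of_eventuallyEq ?_
    filter_upwards [continuous_abs.continuousAt.eventually_lt_const h0] with r hr
    exact ((hf r hr).total_eq hU₁ hm).symm
  obtain ⟨v, hv⟩ := exists_hasDerivAt_act hf0 hU₁ ⟨z, hzU₁⟩ fun z' hz' =>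
    (hQ (jet z' 0 0 0 0 0 0, c) ⟨by rwa [toBase_jet], hcW₁⟩).differentiableAt.fst
  exact ⟨U₁, hU₁.mem_nhds hzU₁, W₁, hW₁.mem_nhds hcW₁, v, fun m hm => (hQ m hm).unique (hv _)⟩

theorem exists_eq_field (hU : IsOpen U) (hUc : IsConnected U) (hne : W.Nonempty) :
    ∃ v, ∀ m ∈ cylinder U W, Q m = field v (toTotal m) := by
  obtain ⟨Q₀, hQ₀⟩ := h.projectable
  have hlocal (z : Base) (hz : z ∈ U) (c : ℝ) (hc : c ∈ W) : ∃ v,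
      (∀ m : ExtJet, toBase m.1 = z → m.2 = c → Q m = field v (toTotal m)) ∧
        ∀ᶠ z' in 𝓝 z, Q₀ z' = (field v (z', 0)).1 := by
    obtain ⟨U₁, hU₁, W₁, hW₁, v, hv⟩ := h.exists_eq_field_locally hS hz hc
    refine ⟨v, ?_, ?_⟩
    · rintro m rfl rfl
      exact hv m ⟨mem_of_mem_nhds hU₁, mem_of_mem_nhds hW₁⟩
    · filter_upwards [hU₁, hU.mem_nhds hz] with z' hz' hz'U
      have hQ := hQ₀ (jet z' 0 0 0 0 0 0, c) ⟨by rwa [toBase_jet], hc⟩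
      rw [hv _ ⟨by rwa [toBase_jet], mem_of_mem_nhds hW₁⟩, toTotal, toBase_jet] at hQ
      exact hQ.symm
  obtain ⟨c, hc⟩ := hne
  obtain ⟨v, hv⟩ := exists_eventuallyEq_field_of_isConnected hUc fun z hz =>
    (hlocal z hz c hc).imp fun _ => And.right
  refine ⟨v, fun m hm => ?_⟩
  obtain ⟨v', hv', hQ₀'⟩ := hlocal _ hm.1 _ hm.2
  have hvv' : v' = v := eq_of_eventuallyEq_field <| by
    filter_upwards [hQ₀', hv _ hm.1] with z' h1 h2
    rw [← h1, h2]
  exact hvv' ▸ hv' m rfl rfl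

end IsInfinitesimalEquivalence

/-- A similarity as a transformation of the extended jet space. -/
def Similarity.toTransf (f : Similarity) : Transf where
  base := f.base
  arb m := f.τ * f.b ^ 2 * m.2

theorem Similarity.actsAs_toTransf (f : Similarity) (U : Set Base) (W : Set ℝ) :
    ActsAs f.toTransf f U W :=
  ⟨fun _ _ => rfl, fun _ _ => rfl⟩

theorem Similarity.toTotal_act_toTransf (f : Similarity) (m : ExtJet) :
    toTotal (f.toTransf.act m) = f.act (toTotal m) := by
  rw [toTotal, Transf.act, toBase_prolong]
  rfl

theorem contDiff_toTotal : ContDiff ℝ ∞ toTotal := by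
  refine ContDiff.prodMk (contDiff_pi.2 fun i => ?_) contDiff_snd
  fin_cases i <;> simp only [toBase, Fin.reduceFinMk, Matrix.cons_val] <;> fun_prop

theorem contDiff_field (c : Fin 5 → ℝ) : ContDiff ℝ ∞ (field c) := by
  refine ContDiff.prodMk (contDiff_pi.2 fun i => ?_) (by fun_prop)
  fin_cases i <;> simp only [Fin.reduceFinMk, Matrix.cons_val] <;> fun_prop

theorem contDiff_flow_act (c : Fin 5 → ℝ) :
    ContDiff ℝ ∞ fun p : ℝ × Total => (flow c p.1).act p.2 := by
  refine ContDiff.prodMk (contDiff_pi.2 fun i => ?_)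
    (by simp only [flow, Units.val_mk0]; fun_prop)
  fin_cases i <;>
    simp only [flow, base, Units.val_mk0, Fin.reduceFinMk, Matrix.cons_val] <;> fun_prop

theorem exists_flow_act_mem_prod (v : Fin 5 → ℝ) {U : Set Base} {W : Set ℝ} (hU : IsOpen U)
    (hW : IsOpen W) {z : Base} (hz : z ∈ U) {c : ℝ} (hc : c ∈ W) :
    ∃ ε > 0, ∀ s, |s| < ε → ∀ y : Total, y.1 ∈ Metric.ball z ε → y.2 ∈ Metric.ball c ε →
      (flow v s).act y ∈ U ×ˢ W := by
  have hmem : (flow v 0).act (z, c) ∈ U ×ˢ W := by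
    rw [flow_zero, act_one]
    exact ⟨hz, hc⟩
  obtain ⟨ε, hε, hball⟩ := Metric.mem_nhds_iff.1
    ((contDiff_flow_act v).continuous.continuousAt.preimage_mem_nhds
      (x := (0, (z, c))) ((hU.prod hW).mem_nhds hmem))
  refine ⟨ε, hε, fun s hs y hy hyc => ?_⟩
  have hsy : (s, y) ∈ Metric.ball (0, (z, c)) ε := by
    rw [← ball_prod_same, ← ball_prod_same]
    exact ⟨by rwa [mem_ball_zero_iff], hy, hyc⟩
  exact hball hsy

theorem isInfinitesimalEquivalence_of_eq_field {S : Set ArbElem} (hS : IsSimilarityInvariant S)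
    {U : Set Base} {W : Set ℝ} (hU : IsOpen U) (hW : IsOpen W) {Q : ExtJet → Total}
    {v : Fin 5 → ℝ} (hQ : ∀ m ∈ cylinder U W, Q m = field v (toTotal m)) :
    IsInfinitesimalEquivalence S U W Q where
  smooth := ((contDiff_field v).comp contDiff_toTotal).contDiffOn.congr hQ
  projectable := ⟨fun z => (field v (z, 0)).1, fun m hm => by rw [hQ m hm]; rfl⟩
  generates z hz c hc := by
    obtain ⟨ε, hε, hflow⟩ := exists_flow_act_mem_prod v hU hW hz hc
    have hsub (y : Total) (hy : y.1 ∈ Metric.ball z ε) (hyc : y.2 ∈ Metric.ball c ε) :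
        y ∈ U ×ˢ W := by
      simpa only [flow_zero, act_one] using hflow 0 (by rwa [abs_zero]) y hy hyc
    refine ⟨Metric.ball z ε, fun z' hz' => (hsub (z', c) hz' (Metric.mem_ball_self hε)).1,
      Metric.ball c ε, fun c' hc' => (hsub (z, c') (Metric.mem_ball_self hε) hc').2,
      ε, hε, fun s => (flow v s).toTransf, Metric.isOpen_ball, Metric.isConnected_ball hε,
      Metric.mem_ball_self hε, Metric.isOpen_ball, Metric.mem_ball_self hε, fun s _ =>
      ((flow v s).actsAs_toTransf _ _).isEquivalenceTransformation Metric.isOpen_ball hS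
        Metric.isOpen_ball, ?_, ?_, fun z' _ => ?_, fun m _ => ?_, fun s hs m hm => ?_⟩
    · exact ((contDiff_flow_act v).fst.comp (g := fun p : ℝ × Total => ((flow v p.1).act p.2).1)
        (contDiff_fst.prodMk (contDiff_snd.prodMk (contDiff_const (c := 0))))).contDiffOn
    · exact ((contDiff_flow_act v).snd.comp
        (contDiff_fst.prodMk (contDiff_toTotal.comp contDiff_snd))).contDiffOn
    · simp only [toTransf, flow_zero, base_one]
    · simp [toTransf, flow_zero, one_def]
    · have hmem := hflow s hs (toTotal m) hm.1.1 hm.1.2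
      rw [← Similarity.toTotal_act_toTransf] at hmem
      refine ⟨hmem, ?_⟩
      rw [hQ _ hmem, Similarity.toTotal_act_toTransf]
      exact hasDerivAt_flow v (toTotal m) s

/-! ### The equivalence group -/

theorem exists_mem_generatedGroup_iff {U : Set Base} {W : Set ℝ} (hne : W.Nonempty)
    {φ : Transf} :
    (∃ σ ∈ generatedGroup, (∀ z ∈ U, ∀ c ∈ W, φ.base z = (σ (z, c)).1) ∧
      ∀ m ∈ φ.domain U W, φ.arb m = (σ (toTotal m)).2) ↔ ∃ f, ActsAs φ f U W := by
  rw [generatedGroup_eq]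
  constructor
  · rintro ⟨_, ⟨f, rfl⟩, hbase, harb⟩
    obtain ⟨c, hc⟩ := hne
    exact ⟨f, fun z hz => hbase z hz c hc, harb⟩
  · rintro ⟨f, hf⟩
    exact ⟨_, ⟨f, rfl⟩, fun z hz _ _ => hf.base_eqOn hz, hf.arb_eq⟩

theorem isEquivalenceTransformation_iff_exists_actsAs {S : Set ArbElem}
    (hS : HasNonzeroConstants S) (hSinv : IsSimilarityInvariant S) {U : Set Base} {W : Set ℝ}
    (hU : IsOpen U) (hUc : IsConnected U) (hW : IsOpen W) (hne : W.Nonempty) {φ : Transf} :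
    IsEquivalenceTransformation S U W φ ↔ ∃ f, ActsAs φ f U W :=
  ⟨fun h => h.exists_actsAs hS hU hUc hW hne,
    fun ⟨_, hf⟩ => hf.isEquivalenceTransformation hU hSinv hW⟩

theorem isInfinitesimalEquivalence_iff_exists_mem_fieldSpan {S : Set ArbElem}
    (hS : HasNonzeroConstants S) (hSinv : IsSimilarityInvariant S) {U : Set Base} {W : Set ℝ}
    (hU : IsOpen U) (hUc : IsConnected U) (hW : IsOpen W) (hne : W.Nonempty)
    {Q : ExtJet → Total} : IsInfinitesimalEquivalence S U W Q ↔
      ∃ v ∈ fieldSpan, ∀ m ∈ cylinder U W, Q m = v (toTotal m) := by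
  constructor
  · intro h
    obtain ⟨v, hv⟩ := h.exists_eq_field hS hU hUc hne
    exact ⟨_, mem_fieldSpan_iff.2 ⟨v, rfl⟩, hv⟩
  · rintro ⟨_, hv, hQ⟩
    obtain ⟨v, rfl⟩ := mem_fieldSpan_iff.1 hv
    exact isInfinitesimalEquivalence_of_eq_field hSinv hU hW hQ

end ShallowWater

end

theorem mainTheorem2_general (S : Set ShallowWater.ArbElem)
    (hS : ShallowWater.HasNonzeroConstants S) (hSinv : ShallowWater.IsSimilarityInvariant S) :
    LinearIndependent ℝ ShallowWater.basisField ∧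
    (ShallowWater.discrete₁ ∉ ShallowWater.continuousGroup ∧
      ShallowWater.discrete₂ ∉ ShallowWater.continuousGroup ∧
      ShallowWater.discrete₁ * ShallowWater.discrete₂ ∉ ShallowWater.continuousGroup) ∧
    ∀ (U : Set ShallowWater.Base) (W : Set ℝ), IsOpen U → IsConnected U →
      IsOpen W → W.Nonempty →
      (∀ Q : ShallowWater.ExtJet → ShallowWater.Total,
        ShallowWater.IsInfinitesimalEquivalence S U W Q ↔
          ∃ v ∈ ShallowWater.fieldSpan, ∀ m ∈ ShallowWater.cylinder U W,
            Q m = v (ShallowWater.toTotal m)) ∧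
      (∀ φ : ShallowWater.Transf,
        ShallowWater.IsEquivalenceTransformation S U W φ ↔
          ∃ σ ∈ ShallowWater.generatedGroup,
            (∀ z ∈ U, ∀ c ∈ W, φ.base z = (σ (z, c)).1) ∧
            ∀ m ∈ φ.domain U W, φ.arb m = (σ (ShallowWater.toTotal m)).2) :=
  ⟨ShallowWater.linearIndependent_basisField,
    ⟨ShallowWater.discrete₁_notMem_continuousGroup, ShallowWater.discrete₂_notMem_continuousGroup,
      ShallowWater.discrete₁_mul_discrete₂_notMem_continuousGroup⟩,
    fun _ _ hU hUc hW hne =>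
      ⟨fun _ => ShallowWater.isInfinitesimalEquivalence_iff_exists_mem_fieldSpan hS hSinv hU hUc hW
          hne,
        fun _ => (ShallowWater.isEquivalenceTransformation_iff_exists_actsAs hS hSinv hU hUc hW
          hne).trans (ShallowWater.exists_mem_generatedGroup_iff hne).symm⟩⟩

theorem mainTheorem2 (S : Set ShallowWater.ArbElem)
    (hS : S = ShallowWater.allElements ∨ S = ShallowWater.nonvanishingElements) :
    LinearIndependent ℝ ShallowWater.basisField ∧
    (ShallowWater.discrete₁ ∉ ShallowWater.continuousGroup ∧
      ShallowWater.discrete₂ ∉ ShallowWater.continuousGroup ∧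
      ShallowWater.discrete₁ * ShallowWater.discrete₂ ∉ ShallowWater.continuousGroup) ∧
    ∀ (U : Set ShallowWater.Base) (W : Set ℝ), IsOpen U → IsConnected U →
      IsOpen W → W.Nonempty →
      (∀ Q : ShallowWater.ExtJet → ShallowWater.Total,
        ShallowWater.IsInfinitesimalEquivalence S U W Q ↔
          ∃ v ∈ ShallowWater.fieldSpan, ∀ m ∈ ShallowWater.cylinder U W,
            Q m = v (ShallowWater.toTotal m)) ∧
      (∀ φ : ShallowWater.Transf,
        ShallowWater.IsEquivalenceTransformation S U W φ ↔
          ∃ σ ∈ ShallowWater.generatedGroup,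
            (∀ z ∈ U, ∀ c ∈ W, φ.base z = (σ (z, c)).1) ∧
            ∀ m ∈ φ.domain U W, φ.arb m = (σ (ShallowWater.toTotal m)).2) := by
  rcases hS with rfl | rfl
  · exact mainTheorem2_general _ ShallowWater.hasNonzeroConstants_allElements
      ShallowWater.isSimilarityInvariant_allElements
  · exact mainTheorem2_general _ ShallowWater.hasNonzeroConstants_nonvanishingElements
      ShallowWater.isSimilarityInvariant_nonvanishingElements
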